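/- Let $k$ be a field and let $K$ be an algebraic function field of one variable over $k$ (a finite extension of $k(x)$ for some $x\in K$ transcendental over $k$) such that $k$ is algebraically closed in $K$. A place of $K$ is given by a valuation ring $\mathcal{O}_P$ of $K$ with $k\subseteq\mathcal{O}_P\subsetneq K$; its degree is the dimension over $k$ of its residue field. Fix a place $\infty$ of $K$, let $K_\infty$ be the completion of $K$ at $\infty$, let $\mathcal{O}_\infty$ be its valuation ring, and let $C$ be the ring of all elements of $K$ that are integral at every place other than $\infty$. The group $G=GL_2(C)$ acts by left multiplication on the vertices of the Bruhat–Tits tree of $GL_2(K_\infty)$, that is, on the left cosets in $GL_2(K_\infty)$ of the subgroup generated by $GL_2(\mathcal{O}_\infty)$ and the scalar matrices. Let $G_v$ be the stabilizer in $G$ of a vertex $v$, and let $Z$ be the group of scalar matrices in $G$. The two eigenvalues of a matrix in $G$ are taken in an algebraic closure of $K$. Assume that $k$ is not quadratically closed, i.e. that some quadratic polynomial over $k$ has no root in $k$. Then: (a) Suppose that the eigenvalues of every matrix in $G_v$ lie in $k$ and that at least one matrix in $G_v$ has distinct eigenvalues. Then there is a normal subgroup $N$ of $G_v$, isomorphic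 to the additive group $V^+$ of a finite-dimensional $k$-vector space $V$, such that $G_v/N\cong k^*\times k^*$. (b) Suppose that every matrix in $G_v$ has repeated eigenvalues lying in $k$. Then $Z\le G_v$, $Z\cong k^*$, and $G_v$ is the internal direct product $Z\times N$ of $Z$ and a subgroup $N$ that is isomorphic to the additive group of a finite-dimensional $k$-vector space. (c) Suppose that $G_v$ contains a matrix whose eigenvalues are distinct and do not lie in $k$. Then $G_v$ is isomorphic to one of the following: (i) $L^*$, where $L$ is a separable quadratic field extension of $k$; (ii) $GL_2(k)$; (iii) $Q^*$, where $Q$ is a quaternion division algebra over $k$ (a division algebra of dimension $4$ over $k$ with centre $k$). (d) Suppose that every matrix in $G_v$ has repeated eigenvalues and that at least one matrix in $G_v$ has eigenvalues not in $k$. Then $\operatorname{char}(k)=2$, and there are an integer $m\ge 1$ and a purely inseparable field extension $F$ of $k$ of degree $2^m$ such that $G_v\cong F^*$ and $2^{m-1}$ divides the degree of every place of $K$. -/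

import Mathlib

universe u v w

open Polynomial IntermediateField

noncomputable section

/-- A field `k` is quadratically closed if every quadratic polynomial over `k` has a root in `k`. -/
def QuadraticallyClosed (k : Type u) [Field k] : Prop :=
  ∀ p : k[X], p.natDegree = 2 → ∃ x : k, p.IsRoot x

/-- `K` is an algebraic function field of one variable over `k`, i.e. a finite extension of `k(x)`
for some `x` transcendental over `k`, and `k` is algebraically closed in `K`
(`k` is the constant field of `K`). -/
structure IsFunctionFieldWithConstantField (k : Type u) (K : Type v) [Field k] [Field K]
    [Algebra k K] : Prop where
  finite_over_rational :
    ∃ x : K, Transcendental k x ∧ FiniteDimensional k⟮x⟯ K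
  constants : ∀ x : K, IsAlgebraic k x → ∃ c : k, algebraMap k K c = x

/-- A place of `K/k`, given by its valuation ring: a valuation ring of `K` containing `k` and
different from `K`. -/
structure Place (k : Type u) (K : Type v) [Field k] [Field K] [Algebra k K] where
  ring : ValuationSubring K
  algebraMap_mem : ∀ c : k, algebraMap k K c ∈ ring
  ne_top : ring ≠ ⊤

namespace Place

variable {k : Type u} {K : Type v} [Field k] [Field K] [Algebra k K]

instance instAlgebraRing (P : Place k K) : Algebra k P.ring :=
  ((algebraMap k K).codRestrict P.ring.toSubring P.algebraMap_mem).toAlgebra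

/-- The degree of a place: the dimension over `k` of its residue field. -/
def degree (P : Place k K) : ℕ :=
  Module.finrank k (IsLocalRing.ResidueField P.ring)

/-- The ring of all elements of `K` that are integral (i.e. have no pole) outside the place `P`. -/
def integralOutside (P : Place k K) : Subalgebra k K where
  carrier := {x | ∀ P' : Place k K, P' ≠ P → x ∈ P'.ring}
  mul_mem' hx hy P' h := P'.ring.mul_mem _ _ (hx P' h) (hy P' h)
  add_mem' hx hy P' h := P'.ring.add_mem _ _ (hx P' h) (hy P' h)
  algebraMap_mem' c P' _ := P'.algebraMap_mem c

/-- The completion of `K` with respect to the place `P`. -/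
abbrev Completion (P : Place k K) : Type v :=
  P.ring.valuation.Completion

/-- The embedding of `K` into its completion at `P`. -/
def toCompletion (P : Place k K) : K →+* P.Completion :=
  (UniformSpace.Completion.coeRingHom (α := WithVal P.ring.valuation)).comp
    (WithVal.equiv P.ring.valuation).symm.toRingHom

/-- The completion of the valuation ring of `P`, i.e. the valuation ring of the completion. -/
def completedRing (P : Place k K) : ValuationSubring P.Completion :=
  (Valued.v : Valuation P.Completion P.ring.ValueGroup).valuationSubring

/-- The subgroup `GL₂(𝒪_P)` of `GL₂(K_P)`. -/
def integralMatrices (P : Place k K) : Subgroup (GL (Fin 2) P.Completion) :=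
  (Matrix.GeneralLinearGroup.map (n := Fin 2) P.completedRing.subtype).range

/-- The subgroup of scalar matrices in `GL₂(K_P)`. -/
def scalarsCompletion (P : Place k K) : Subgroup (GL (Fin 2) P.Completion) :=
  (Matrix.GeneralLinearGroup.scalar (Fin 2) (R := P.Completion)).range

/-- The vertices of the Bruhat-Tits tree of `GL₂(K_P)`: the left cosets in `GL₂(K_P)` of the
subgroup generated by the scalar matrices and `GL₂(𝒪_P)` (equivalently, the homothety classes of
lattices in `K_P ^ 2`); `GL₂(K_P)` acts on them by left multiplication. -/
abbrev TreeVertex (P : Place k K) : Type v :=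
  GL (Fin 2) P.Completion ⧸ (P.scalarsCompletion ⊔ P.integralMatrices)

/-- The group `GL₂(C)`, where `C` is the ring of elements of `K` integral outside `P`. -/
abbrev DrinfeldGroup (P : Place k K) : Type v :=
  GL (Fin 2) P.integralOutside

/-- The embedding of `GL₂(C)` into `GL₂(K_P)`, through which `GL₂(C)` acts on the tree. -/
def drinfeldEmbedding (P : Place k K) : P.DrinfeldGroup →* GL (Fin 2) P.Completion :=
  Matrix.GeneralLinearGroup.map (P.toCompletion.comp P.integralOutside.val.toRingHom)

/-- The stabilizer in `GL₂(C)` of a vertex of the Bruhat-Tits tree. -/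
def vertexStabilizer (P : Place k K) (x : P.TreeVertex) : Subgroup P.DrinfeldGroup :=
  (MulAction.stabilizer (GL (Fin 2) P.Completion) x).comap P.drinfeldEmbedding

/-- The subgroup of scalar matrices in `GL₂(C)`. -/
def scalars (P : Place k K) : Subgroup P.DrinfeldGroup :=
  (Matrix.GeneralLinearGroup.scalar (Fin 2) (R := P.integralOutside)).range

/-- The two eigenvalues, with multiplicity, of a matrix in `GL₂(C)`: the roots of its
characteristic polynomial in an algebraic closure of `K`. -/
def eigenvalues (P : Place k K) (M : P.DrinfeldGroup) : Multiset (AlgebraicClosure K) :=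
  ((M : Matrix (Fin 2) (Fin 2) P.integralOutside).charpoly.map
    ((algebraMap K (AlgebraicClosure K)).comp P.integralOutside.val.toRingHom)).roots

/-- The two eigenvalues of the matrix are different. -/
def HasDistinctEigenvalues (P : Place k K) (M : P.DrinfeldGroup) : Prop :=
  (P.eigenvalues M).Nodup

/-- The two eigenvalues of the matrix coincide. -/
def HasRepeatedEigenvalues (P : Place k K) (M : P.DrinfeldGroup) : Prop :=
  ¬ (P.eigenvalues M).Nodup

/-- All eigenvalues of the matrix lie in `k`. -/
def HasEigenvaluesIn (P : Place k K) (M : P.DrinfeldGroup) : Prop :=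
  ∀ l ∈ P.eigenvalues M, ∃ c : k, algebraMap K (AlgebraicClosure K) (algebraMap k K c) = l

/-- No eigenvalue of the matrix lies in `k`. -/
def HasEigenvaluesNotIn (P : Place k K) (M : P.DrinfeldGroup) : Prop :=
  ∀ l ∈ P.eigenvalues M, ¬ ∃ c : k, algebraMap K (AlgebraicClosure K) (algebraMap k K c) = l

end Place

/-- The group `N` is isomorphic to the additive group of a finite-dimensional vector space
over `k`. -/
def IsFiniteDimensionalVectorGroup (k : Type u) [Field k] (N : Type v) [Group N] : Prop :=
  ∃ (V : Type v) (_ : AddCommGroup V) (_ : Module k V),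
    FiniteDimensional k V ∧ Nonempty (N ≃* Multiplicative V)

/-- The group `Γ` is the internal direct product of its subgroups `A` and `B`. -/
def IsInternalDirectProduct {Γ : Type w} [Group Γ] (A B : Subgroup Γ) : Prop :=
  (∀ a ∈ A, ∀ b ∈ B, a * b = b * a) ∧ A ⊓ B = ⊥ ∧ A ⊔ B = ⊤

end

/-!
Let `g` represent the vertex and let `A` be the `k`-algebra of matrices `X` over `C` such that
`g⁻¹ X g` is integral (`Place.vertexAlgebra`). The determinant of an element of `GL₂(C)` is a
constant, so that an element of the stabilizer can only involve scalars that are units of the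
completed valuation ring; hence the stabilizer is the unit group `Aˣ`
(`IsFunctionFieldWithConstantField.exists_mulEquiv_units`).

Two facts about `A` determine its structure. First, traces and determinants of elements of `A` are
integral at all places, so they lie in `k`, and an element of `A` is a unit as soon as its
determinant is nonzero. Second, `A` has finite dimension over `k`. The entries of its elements have
poles of bounded order at `∞` only, say they lie in `b⁻¹ 𝒪_∞` with `b` in the maximal ideal;
elements of this module that are independent over `k` modulo `𝒪_∞` are independent over `k(b)`, and
`[K : k(b)]` is finite (`IsFunctionFieldWithConstantField.finite_boundedPole`).

The rest is a classification of the subalgebras `A` of `M₂(K)` with the first property. If `A`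
contains a nontrivial idempotent, its Peirce decomposition shows that, up to conjugation, `A` is
triangular or equal to `M₂(k)` (`HasConstantCharpolys.triangular_or_full`). If `A` contains a matrix
without eigenvalues in `k`, it is a conjugate of `M₂(k)` or a division algebra
(`HasConstantCharpolys.full_or_division`).

* In (a) a spectral projection is a nontrivial idempotent, and `M₂(k)` is excluded by the companion
  matrix of a quadratic polynomial without roots. The diagonal of a triangular matrix gives the map
  onto `kˣ × kˣ`.
* In (b) the nilpotent elements of `A` annihilate each other, so that `1 + n ↦ n` identifies the
  unipotent elements with a vector space.
* In (c), let `A` be a division algebra containing a separable `w` not in `k`. Then either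
  `A = k[w]`, or `1, w, a, w a` is a basis of `M₂(K)` for some `a` in `A`, and nondegeneracy of the
  trace form shows that `A` has dimension four and centre `k`.
* In (d) all traces vanish and the characteristic is two, so `A` is commutative and all squares are
  constants: `A` is a purely inseparable field. Reduction at a place embeds it into an algebra of
  dimension two over the residue field (`HasConstantCharpolys.finrank_dvd`).
-/

noncomputable section

/-! ### Algebras of two by two matrices with constant characteristic polynomials -/

section

open Matrix

variable {k : Type u} {K : Type v} [Field k] [Field K] [Algebra k K]

/-- The traces and determinants of the elements of `A` lie in `k`. -/
def HasConstantCharpolys (A : Subalgebra k (Matrix (Fin 2) (Fin 2) K)) : Prop :=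
  ∀ X ∈ A, (∃ t : k, algebraMap k K t = X.trace) ∧ ∃ d : k, algebraMap k K d = X.det

/-- `φ` preserves traces and determinants, as conjugations do. -/
def PreservesCharpoly (φ : Matrix (Fin 2) (Fin 2) K ≃ₐ[k] Matrix (Fin 2) (Fin 2) K) : Prop :=
  ∀ X, (φ X).trace = X.trace ∧ (φ X).det = X.det

lemma sq_eq_trace_smul_sub_det (X : Matrix (Fin 2) (Fin 2) K) :
    X * X = X.trace • X - X.det • (1 : Matrix (Fin 2) (Fin 2) K) := by
  ext i j
  fin_cases i <;> fin_cases j <;> simp [mul_apply, Fin.sum_univ_two, trace_fin_two, det_fin_two] <;>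
    ring

lemma algebraMap_smul_mem {A : Subalgebra k (Matrix (Fin 2) (Fin 2) K)} (c : k)
    {X : Matrix (Fin 2) (Fin 2) K} (hX : X ∈ A) : algebraMap k K c • X ∈ A := by
  rw [algebraMap_smul]
  exact A.smul_mem hX c

lemma HasConstantCharpolys.inv_mem {A : Subalgebra k (Matrix (Fin 2) (Fin 2) K)}
    (hA : HasConstantCharpolys A) {X : Matrix (Fin 2) (Fin 2) K} (hX : X ∈ A)
    (hd : X.det ≠ 0) : ∃ Y ∈ A, X * Y = 1 ∧ Y * X = 1 := by
  obtain ⟨⟨t, ht⟩, d, hdd⟩ := hA X hX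
  have h2 := sq_eq_trace_smul_sub_det X
  refine ⟨algebraMap k K d⁻¹ • (algebraMap k K t • 1 - X), algebraMap_smul_mem _
    (A.sub_mem (algebraMap_smul_mem _ A.one_mem) hX), ?_⟩
  have key : (algebraMap k K d)⁻¹ • (X.trace • X - X * X) = 1 := by
    rw [h2, sub_sub_cancel, hdd, smul_smul, inv_mul_cancel₀ hd, one_smul]
  constructor
  · rw [mul_smul_comm, mul_sub, mul_smul_comm, mul_one, ht, map_inv₀, key]
  · rw [smul_mul_assoc, sub_mul, smul_mul_assoc, one_mul, ht, map_inv₀, key]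

/-- The unit of `A` given by an invertible matrix in `A`. -/
def HasConstantCharpolys.unit {A : Subalgebra k (Matrix (Fin 2) (Fin 2) K)}
    (hA : HasConstantCharpolys A) {X : Matrix (Fin 2) (Fin 2) K} (hX : X ∈ A)
    (hd : X.det ≠ 0) : Aˣ where
  val := ⟨X, hX⟩
  inv := ⟨(hA.inv_mem hX hd).choose, (hA.inv_mem hX hd).choose_spec.1⟩
  val_inv := Subtype.ext (hA.inv_mem hX hd).choose_spec.2.1
  inv_val := Subtype.ext (hA.inv_mem hX hd).choose_spec.2.2

lemma det_ne_zero_of_unit {A : Subalgebra k (Matrix (Fin 2) (Fin 2) K)} (g : Aˣ) :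
    (g : A).1.det ≠ 0 := by
  intro h
  have h1 : ((g : A) * (↑g⁻¹ : A)).1 = (1 : Matrix (Fin 2) (Fin 2) K) := by
    rw [Units.mul_inv]; rfl
  have h2 := congrArg Matrix.det h1
  rw [show ((g : A) * (↑g⁻¹ : A)).1 = (g : A).1 * (↑g⁻¹ : A).1 from rfl, det_mul, h] at h2
  simp at h2

/-- Conjugation `X ↦ h⁻¹ X h`. -/
def conjEquiv (k : Type u) [Field k] [Algebra k K] (h : GL (Fin 2) K) :
    Matrix (Fin 2) (Fin 2) K ≃ₐ[k] Matrix (Fin 2) (Fin 2) K :=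
  AlgEquiv.ofAlgHom
    { toFun := fun X => (h⁻¹).1 * X * h.1
      map_one' := by simp
      map_mul' := fun X Y => by
        have : h.1 * (h⁻¹).1 = 1 := by rw [← Units.val_mul, mul_inv_cancel]; rfl
        calc (h⁻¹).1 * (X * Y) * h.1 = (h⁻¹).1 * X * 1 * Y * h.1 := by
              simp only [mul_assoc, one_mul]
          _ = _ := by rw [← this]; simp only [mul_assoc]
      map_zero' := by simp
      map_add' := fun X Y => by rw [mul_add, add_mul]
      commutes' := fun c => by
        rw [← Algebra.commutes, mul_assoc, ← Units.val_mul, inv_mul_cancel]; simp }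
    { toFun := fun X => h.1 * X * (h⁻¹).1
      map_one' := by simp
      map_mul' := fun X Y => by
        have : (h⁻¹).1 * h.1 = 1 := by rw [← Units.val_mul, inv_mul_cancel]; rfl
        calc h.1 * (X * Y) * (h⁻¹).1 = h.1 * X * 1 * Y * (h⁻¹).1 := by
              simp only [mul_assoc, one_mul]
          _ = _ := by rw [← this]; simp only [mul_assoc]
      map_zero' := by simp
      map_add' := fun X Y => by rw [mul_add, add_mul]
      commutes' := fun c => by
        rw [← Algebra.commutes, mul_assoc, ← Units.val_mul, mul_inv_cancel]; simp }
    (by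
      ext1 X
      have : (h⁻¹).1 * h.1 = 1 := by rw [← Units.val_mul, inv_mul_cancel]; rfl
      change (h⁻¹).1 * (h.1 * X * (h⁻¹).1) * h.1 = X
      rw [← mul_assoc, ← mul_assoc, this, one_mul, mul_assoc, this, mul_one])
    (by
      ext1 X
      have : h.1 * (h⁻¹).1 = 1 := by rw [← Units.val_mul, mul_inv_cancel]; rfl
      change h.1 * ((h⁻¹).1 * X * h.1) * (h⁻¹).1 = X
      rw [← mul_assoc, ← mul_assoc, this, one_mul, mul_assoc, this, mul_one])

lemma conjEquiv_apply (h : GL (Fin 2) K) (X : Matrix (Fin 2) (Fin 2) K) :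
    conjEquiv k h X = (h⁻¹).1 * X * h.1 := rfl

lemma preservesCharpoly_conjEquiv (h : GL (Fin 2) K) : PreservesCharpoly (conjEquiv k h) := by
  intro X
  have e : h.1 * (h⁻¹).1 = 1 := by rw [← Units.val_mul, mul_inv_cancel]; rfl
  rw [conjEquiv_apply]
  constructor
  · rw [trace_mul_comm, ← mul_assoc, e, one_mul]
  · have := congrArg Matrix.det e
    rw [det_mul, det_one] at this
    rw [det_mul, det_mul]
    linear_combination X.det * this

lemma PreservesCharpoly.trans {φ ψ : Matrix (Fin 2) (Fin 2) K ≃ₐ[k] Matrix (Fin 2) (Fin 2) K}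
    (hφ : PreservesCharpoly φ) (hψ : PreservesCharpoly ψ) : PreservesCharpoly (φ.trans ψ) :=
  fun X => ⟨(hψ _).1.trans (hφ X).1, (hψ _).2.trans (hφ X).2⟩

lemma HasConstantCharpolys.map {A : Subalgebra k (Matrix (Fin 2) (Fin 2) K)}
    (hA : HasConstantCharpolys A)
    {φ : Matrix (Fin 2) (Fin 2) K ≃ₐ[k] Matrix (Fin 2) (Fin 2) K} (hφ : PreservesCharpoly φ) :
    HasConstantCharpolys (A.map φ.toAlgHom) := by
  rintro _ ⟨X, hX, rfl⟩
  have h1 := hφ X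
  obtain ⟨⟨t, ht⟩, d, hd⟩ := hA X hX
  exact ⟨⟨t, ht.trans h1.1.symm⟩, d, hd.trans h1.2.symm⟩

/-- A rank one idempotent can be conjugated to the matrix unit `e₁₁`. -/
lemma exists_conj_idempotent {e : Matrix (Fin 2) (Fin 2) K} (hd : e.det = 0) (ht : e.trace = 1) :
    ∃ h : GL (Fin 2) K, conjEquiv k h e = !![1, 0; 0, 0] := by
  -- the columns of `h` are eigenvectors of `e`
  suffices H : ∃ h : GL (Fin 2) K, e * h.1 = h.1 * !![1, 0; 0, 0] by
    obtain ⟨h, hh⟩ := H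
    refine ⟨h, ?_⟩
    rw [conjEquiv_apply, mul_assoc, hh, ← mul_assoc, ← Units.val_mul, inv_mul_cancel]
    simp
  obtain ⟨p, q, r, s, rfl⟩ : ∃ p q r s, e = !![p, q; r, s] := ⟨_, _, _, _, eta_fin_two e⟩
  simp only [det_fin_two_of, trace_fin_two_of] at hd ht
  by_cases hp : p = 0
  · subst hp
    have hs : s = 1 := by linear_combination ht
    subst hs
    refine ⟨GeneralLinearGroup.mkOfDetNeZero !![q, 1; 1, -r] ?_, ?_⟩
    · rw [det_fin_two_of, show q * -r - 1 * 1 = (-1 : K) by linear_combination hd]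
      simp
    · change !![0, q; r, 1] * !![q, 1; 1, -r] = !![q, 1; 1, -r] * !![1, 0; 0, 0]
      have : q * r = 0 := by linear_combination -hd
      ext i j
      fin_cases i <;> fin_cases j <;> rcases mul_eq_zero.1 this with h | h <;> simp [h]
  · refine ⟨GeneralLinearGroup.mkOfDetNeZero !![p, -q; r, p] ?_, ?_⟩
    · rw [det_fin_two_of, show p * p - -q * r = p by linear_combination p * ht - hd]
      exact hp
    · change !![p, q; r, s] * !![p, -q; r, p] = !![p, -q; r, p] * !![1, 0; 0, 0]
      ext i j
      fin_cases i <;> fin_cases j <;> simp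
      · linear_combination p * ht - hd
      · ring
      · linear_combination r * ht
      · linear_combination hd

/-- `A` consists of upper triangular matrices and contains the diagonal idempotents. -/
def IsTriangular (A : Subalgebra k (Matrix (Fin 2) (Fin 2) K)) : Prop :=
  !![1, 0; 0, 0] ∈ A ∧ ∀ X ∈ A, X 1 0 = 0

/-- `A` is the algebra `M₂(k)`. -/
def IsFullConstant (A : Subalgebra k (Matrix (Fin 2) (Fin 2) K)) : Prop :=
  ∀ X, X ∈ A ↔ ∀ i j, ∃ c : k, algebraMap k K c = X i j

lemma peirce_mem {A : Subalgebra k (Matrix (Fin 2) (Fin 2) K)} (he : !![1, 0; 0, 0] ∈ A)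
    {X : Matrix (Fin 2) (Fin 2) K} (hX : X ∈ A) :
    !![X 0 0, 0; 0, 0] ∈ A ∧ !![0, X 0 1; 0, 0] ∈ A ∧ !![0, 0; X 1 0, 0] ∈ A ∧
      !![0, 0; 0, X 1 1] ∈ A := by
  have hf : !![(0 : K), 0; 0, 1] ∈ A := by
    convert! A.sub_mem A.one_mem he using 1
    ext i j; fin_cases i <;> fin_cases j <;> simp
  refine ⟨?_, ?_, ?_, ?_⟩
  · convert! A.mul_mem (A.mul_mem he hX) he using 1
    ext i j; fin_cases i <;> fin_cases j <;> simp [mul_apply, vecMul, dotProduct]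
  · convert! A.mul_mem (A.mul_mem he hX) hf using 1
    ext i j; fin_cases i <;> fin_cases j <;> simp [mul_apply, vecMul, dotProduct]
  · convert! A.mul_mem (A.mul_mem hf hX) he using 1
    ext i j; fin_cases i <;> fin_cases j <;> simp [mul_apply, vecMul, dotProduct]
  · convert! A.mul_mem (A.mul_mem hf hX) hf using 1
    ext i j; fin_cases i <;> fin_cases j <;> simp [mul_apply, vecMul, dotProduct]

lemma HasConstantCharpolys.diag {A : Subalgebra k (Matrix (Fin 2) (Fin 2) K)}
    (hA : HasConstantCharpolys A) (he : !![1, 0; 0, 0] ∈ A)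
    {X : Matrix (Fin 2) (Fin 2) K} (hX : X ∈ A) :
    (∃ c : k, algebraMap k K c = X 0 0) ∧ ∃ c : k, algebraMap k K c = X 1 1 := by
  obtain ⟨h1, -, -, h2⟩ := peirce_mem he hX
  exact ⟨by simpa [trace_fin_two] using (hA _ h1).1, by simpa [trace_fin_two] using (hA _ h2).1⟩

lemma HasConstantCharpolys.mul_antidiag {A : Subalgebra k (Matrix (Fin 2) (Fin 2) K)}
    (hA : HasConstantCharpolys A) (he : !![1, 0; 0, 0] ∈ A)
    {X Y : Matrix (Fin 2) (Fin 2) K} (hX : X ∈ A) (hY : Y ∈ A) :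
    ∃ c : k, algebraMap k K c = X 0 1 * Y 1 0 := by
  obtain ⟨-, h1, -, -⟩ := peirce_mem he hX
  obtain ⟨-, -, h2, -⟩ := peirce_mem he hY
  simpa [trace_fin_two] using (hA _ (A.mul_mem h1 h2)).1

/-- If `A` contains `e₁₁` and matrices with nonzero entries at both off-diagonal places, it becomes
`M₂(k)` after a diagonal conjugation: the products of opposite off-diagonal entries lie in `k`, so
that the off-diagonal entries form lines `k u` and `k u⁻¹`. -/
lemma HasConstantCharpolys.exists_conj_full {A : Subalgebra k (Matrix (Fin 2) (Fin 2) K)}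
    (hA : HasConstantCharpolys A) (he : !![1, 0; 0, 0] ∈ A)
    {X Y : Matrix (Fin 2) (Fin 2) K} (hX : X ∈ A) (hY : Y ∈ A) (hX0 : X 0 1 ≠ 0)
    (hY0 : Y 1 0 ≠ 0) : ∃ h : GL (Fin 2) K, IsFullConstant (A.map (conjEquiv k h).toAlgHom) := by
  set u := X 0 1 with hu
  let h : GL (Fin 2) K := GeneralLinearGroup.mkOfDetNeZero !![u, 0; 0, 1] (by simpa using hX0)
  have hinv : (h⁻¹).1 = !![u⁻¹, 0; 0, 1] := by
    have : (⟨!![u, 0; 0, 1], !![u⁻¹, 0; 0, 1], by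
        ext i j; fin_cases i <;> fin_cases j <;> simp [hX0], by
        ext i j; fin_cases i <;> fin_cases j <;> simp [hX0]⟩ : GL (Fin 2) K) = h := Units.ext rfl
    rw [← this]; rfl
  have hconj : ∀ Z : Matrix (Fin 2) (Fin 2) K,
      conjEquiv k h Z = !![Z 0 0, u⁻¹ * Z 0 1; Z 1 0 * u, Z 1 1] := by
    intro Z
    rw [conjEquiv_apply, hinv]
    change _ * Z * !![u, 0; 0, 1] = _
    ext i j
    fin_cases i <;> fin_cases j <;> simp [mul_apply, Fin.sum_univ_two, vecMul, dotProduct]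
    field_simp
  obtain ⟨c, hc⟩ := hA.mul_antidiag he hX hY
  rw [← hu] at hc
  have hc0 : algebraMap k K c ≠ 0 := hc ▸ mul_ne_zero hX0 hY0
  refine ⟨h, fun Z => ⟨?_, fun hZ => ?_⟩⟩
  · rintro ⟨Z, hZ, rfl⟩
    change ∀ i j, ∃ c : k, algebraMap k K c = conjEquiv k h Z i j
    rw [hconj]
    obtain ⟨⟨a, ha⟩, d, hd⟩ := hA.diag he hZ
    obtain ⟨b, hb⟩ := hA.mul_antidiag he hZ hY
    obtain ⟨b', hb'⟩ := hA.mul_antidiag he hX hZ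
    intro i j
    fin_cases i <;> fin_cases j
    · exact ⟨a, ha⟩
    · refine ⟨b / c, ?_⟩
      simp only [map_div₀, hb, hc]
      simp
      field_simp
    · exact ⟨b', by simp [hb', ← hu, mul_comm]⟩
    · exact ⟨d, hd⟩
  · obtain ⟨a, ha⟩ := hZ 0 0
    obtain ⟨b, hb⟩ := hZ 0 1
    obtain ⟨b', hb'⟩ := hZ 1 0
    obtain ⟨d, hd⟩ := hZ 1 1
    obtain ⟨-, h1, -, -⟩ := peirce_mem he hX
    obtain ⟨-, -, h2, -⟩ := peirce_mem he hY
    have hf : !![(0 : K), 0; 0, 1] ∈ A := by simpa using (peirce_mem he A.one_mem).2.2.2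
    refine ⟨_, A.add_mem (A.add_mem (algebraMap_smul_mem a he) (algebraMap_smul_mem b h1))
      (A.add_mem (algebraMap_smul_mem (b' / c) h2) (algebraMap_smul_mem d hf)), ?_⟩
    change conjEquiv k h _ = Z
    rw [hconj]
    ext i j
    fin_cases i <;> fin_cases j
    · simp [ha]
    · simp [← hu, hb]; field_simp
    · simp [hb', hc]; field_simp
    · simp [hd]

lemma exists_conj_swap {A : Subalgebra k (Matrix (Fin 2) (Fin 2) K)} (he : !![1, 0; 0, 0] ∈ A)
    (hl : ∀ X ∈ A, X 0 1 = 0) :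
    ∃ h : GL (Fin 2) K, IsTriangular (A.map (conjEquiv k h).toAlgHom) := by
  let h : GL (Fin 2) K :=
    ⟨!![0, 1; 1, 0], !![0, 1; 1, 0], by simp [one_fin_two], by simp [one_fin_two]⟩
  have hconj : ∀ Z : Matrix (Fin 2) (Fin 2) K,
      conjEquiv k h Z = !![Z 1 1, Z 1 0; Z 0 1, Z 0 0] := by
    intro Z
    rw [conjEquiv_apply]
    change !![0, 1; 1, 0] * Z * !![0, 1; 1, 0] = _
    ext i j
    fin_cases i <;> fin_cases j <;> simp [mul_apply, Fin.sum_univ_two, vecMul, dotProduct]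
  refine ⟨h, ⟨_, A.sub_mem A.one_mem he, ?_⟩, ?_⟩
  · change conjEquiv k h _ = _
    rw [hconj]
    ext i j
    fin_cases i <;> fin_cases j <;> simp
  · rintro _ ⟨Z, hZ, rfl⟩
    change conjEquiv k h Z 1 0 = 0
    rw [hconj]
    exact hl Z hZ

/-- Peirce decomposition: an algebra with constant characteristic polynomials that contains a
nontrivial idempotent is, up to conjugation, triangular or `M₂(k)`. -/
lemma HasConstantCharpolys.triangular_or_full {A : Subalgebra k (Matrix (Fin 2) (Fin 2) K)}
    (hA : HasConstantCharpolys A) {e : Matrix (Fin 2) (Fin 2) K} (heA : e ∈ A) (hd : e.det = 0)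
    (ht : e.trace = 1) :
    ∃ φ : Matrix (Fin 2) (Fin 2) K ≃ₐ[k] Matrix (Fin 2) (Fin 2) K, PreservesCharpoly φ ∧
      (IsTriangular (A.map φ.toAlgHom) ∨ IsFullConstant (A.map φ.toAlgHom)) := by
  obtain ⟨h, hh⟩ := exists_conj_idempotent (k := k) hd ht
  have hp := preservesCharpoly_conjEquiv (k := k) h
  have hB := hA.map hp
  set φ := conjEquiv k h
  set B := A.map φ.toAlgHom
  have he : !![1, 0; 0, 0] ∈ B := ⟨e, heA, hh⟩
  have comp : ∀ ψ : Matrix (Fin 2) (Fin 2) K ≃ₐ[k] Matrix (Fin 2) (Fin 2) K,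
      A.map (φ.trans ψ).toAlgHom = B.map ψ.toAlgHom := fun ψ => by
    rw [Subalgebra.map_map]; rfl
  by_cases h1 : ∀ X ∈ B, X 1 0 = 0
  · exact ⟨φ, hp, Or.inl ⟨he, h1⟩⟩
  by_cases h2 : ∀ X ∈ B, X 0 1 = 0
  · obtain ⟨h', hh'⟩ := exists_conj_swap he h2
    exact ⟨φ.trans (conjEquiv k h'), hp.trans (preservesCharpoly_conjEquiv _),
      Or.inl (comp _ ▸ hh')⟩
  push Not at h1 h2
  obtain ⟨Y, hY, hY0⟩ := h1
  obtain ⟨X, hX, hX0⟩ := h2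
  obtain ⟨h', hh'⟩ := hB.exists_conj_full he hX hY hX0 hY0
  exact ⟨φ.trans (conjEquiv k h'), hp.trans (preservesCharpoly_conjEquiv _), Or.inr (comp _ ▸ hh')⟩

end

/-! ### Unit groups when all eigenvalues are constants and some are distinct -/

section

open Matrix

variable {k : Type u} {K : Type v} [Field k] [Field K] [Algebra k K]

lemma mul_apply_of_triangular {X Y : Matrix (Fin 2) (Fin 2) K} (hX : X 1 0 = 0) (hY : Y 1 0 = 0) :
    (X * Y) 0 0 = X 0 0 * Y 0 0 ∧ (X * Y) 1 1 = X 1 1 * Y 1 1 ∧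
      (X * Y) 0 1 = X 0 0 * Y 0 1 + X 0 1 * Y 1 1 := by
  simp [mul_apply, Fin.sum_univ_two, hX, hY]

/-- For a triangular algebra, the unipotent matrices in its unit group form the kernel of the
diagonal map onto `kˣ × kˣ`. -/
lemma IsTriangular.exists_hom {A : Subalgebra k (Matrix (Fin 2) (Fin 2) K)}
    (hT : IsTriangular A) (hA : HasConstantCharpolys A) [FiniteDimensional k A] :
    ∃ f : Aˣ →* kˣ × kˣ, Function.Surjective f ∧ IsFiniteDimensionalVectorGroup k f.ker := by
  obtain ⟨he, h10⟩ := hT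
  have inj := (algebraMap k K).injective
  have hmul := fun (X Y : A) => mul_apply_of_triangular (h10 X X.2) (h10 Y Y.2)
  choose a ha using fun X : A => (hA.diag he X.2).1
  choose d hd using fun X : A => (hA.diag he X.2).2
  let α : A →* k :=
    { toFun := a
      map_one' := inj (by rw [ha]; simp)
      map_mul' := fun X Y => inj (by rw [ha, map_mul, ha, ha]; exact (hmul X Y).1) }
  let δ : A →* k :=
    { toFun := d
      map_one' := inj (by rw [hd]; simp)
      map_mul' := fun X Y => inj (by rw [hd, map_mul, hd, hd]; exact (hmul X Y).2.1) }
  have hf : !![(0 : K), 0; 0, 1] ∈ A := by simpa using (peirce_mem he A.one_mem).2.2.2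
  refine ⟨(Units.map α).prod (Units.map δ), ?_, ?_⟩
  · rintro ⟨x, y⟩
    have hmem := A.add_mem (algebraMap_smul_mem (x : k) he) (algebraMap_smul_mem (y : k) hf)
    have hdet : (algebraMap k K (x : k) • !![1, 0; 0, 0] +
        algebraMap k K (y : k) • !![(0 : K), 0; 0, 1]).det ≠ 0 := by
      simp [det_fin_two]
    refine ⟨hA.unit hmem hdet, Prod.ext (Units.ext (inj ?_)) (Units.ext (inj ?_))⟩
    · refine (ha _).trans ?_
      simp [HasConstantCharpolys.unit, Algebra.algebraMap_eq_smul_one]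
    · refine (hd _).trans ?_
      simp [HasConstantCharpolys.unit, Algebra.algebraMap_eq_smul_one]
  · let V : Submodule k K :=
      { carrier := {x | !![0, x; 0, 0] ∈ A}
        add_mem' := fun {x y} hx hy => by
          have := A.add_mem hx hy
          simpa using this
        zero_mem' := by
          change !![(0 : K), 0; 0, 0] ∈ A
          rw [show !![(0 : K), 0; 0, 0] = 0 by ext i j; fin_cases i <;> fin_cases j <;> rfl]
          exact A.zero_mem
        smul_mem' := fun c x hx => by
          have := A.smul_mem hx c
          simpa using this }
    have hV : ∀ x : V, !![0, (x : K); 0, 0] ∈ A := fun x => x.2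
    have hker : ∀ g : Aˣ, g ∈ ((Units.map α).prod (Units.map δ)).ker ↔
        (g : A).1 0 0 = 1 ∧ (g : A).1 1 1 = 1 := by
      intro g
      rw [MonoidHom.mem_ker, Prod.ext_iff, Units.ext_iff, Units.ext_iff, ← inj.eq_iff,
        ← inj.eq_iff (a := ((((Units.map α).prod (Units.map δ)) g).2 : k))]
      change algebraMap k K (a g) = algebraMap k K 1 ∧ algebraMap k K (d g) = algebraMap k K 1 ↔ _
      rw [ha, hd, map_one]
    let ι : V →ₗ[k] A :=
      { toFun := fun x => ⟨!![0, (x : K); 0, 0], hV x⟩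
        map_add' := fun x y => Subtype.ext (by simp)
        map_smul' := fun c x => Subtype.ext (by simp) }
    have hι : Function.Injective ι := fun x y hxy => by
      have := congrArg (fun X : A => X.1 0 1) hxy
      exact Subtype.ext (by simpa [ι] using this)
    refine ⟨V, inferInstance, inferInstance, FiniteDimensional.of_injective ι hι, ⟨?_⟩⟩
    refine MulEquiv.ofBijective
      (MonoidHom.mk' (fun g => Multiplicative.ofAdd
        ⟨(g.1 : A).1 0 1, (peirce_mem he (g.1 : A).2).2.1⟩) ?_) ⟨?_, ?_⟩
    · intro g h
      have hg := (hker g).1 g.2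
      have hh := (hker h).1 h.2
      refine congrArg Multiplicative.ofAdd (Subtype.ext ?_)
      have h01 := (hmul (g.1 : A) (h.1 : A)).2.2
      rw [hg.1, hh.2, one_mul, mul_one, add_comm] at h01
      exact h01
    · intro g h hgh
      have hg := (hker g).1 g.2
      have hh := (hker h).1 h.2
      have h01 : (g.1 : A).1 0 1 = (h.1 : A).1 0 1 := congrArg (fun x => (x.toAdd : V).1) hgh
      refine Subtype.ext (Units.ext (Subtype.ext ?_))
      ext i j
      fin_cases i <;> fin_cases j
      · exact hg.1.trans hh.1.symm
      · exact h01
      · exact (h10 _ (g.1 : A).2).trans (h10 _ (h.1 : A).2).symm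
      · exact hg.2.trans hh.2.symm
    · intro x
      have hmem := A.add_mem A.one_mem (hV x.toAdd)
      have hdet : (1 + !![0, (x.toAdd : K); 0, 0]).det ≠ 0 := by
        simp [det_fin_two]
      refine ⟨⟨hA.unit hmem hdet, (hker _).2 ?_⟩, ?_⟩
      · simp [HasConstantCharpolys.unit]
      · refine congrArg Multiplicative.ofAdd (Subtype.ext ?_)
        simp [HasConstantCharpolys.unit]
        rfl

/-- Transport of the units of an algebra along an automorphism of the matrix algebra. -/
def unitsMapEquiv (A : Subalgebra k (Matrix (Fin 2) (Fin 2) K))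
    (φ : Matrix (Fin 2) (Fin 2) K ≃ₐ[k] Matrix (Fin 2) (Fin 2) K) :
    Aˣ ≃* (A.map φ.toAlgHom)ˣ :=
  Units.mapEquiv (AlgEquiv.subalgebraMap φ A).toMulEquiv

lemma IsFiniteDimensionalVectorGroup.of_mulEquiv {G H : Type v} [Group G] [Group H]
    (h : IsFiniteDimensionalVectorGroup k G) (e : H ≃* G) : IsFiniteDimensionalVectorGroup k H := by
  obtain ⟨V, i1, i2, hV, ⟨f⟩⟩ := h
  exact ⟨V, i1, i2, hV, ⟨e.trans f⟩⟩

/-- Pulling a surjection back along an isomorphism keeps the kernel a vector group. -/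
lemma exists_hom_comp {G H : Type v} [Group G] [Group H] (e : H ≃* G) {Q : Type u} [Group Q]
    (h : ∃ f : G →* Q, Function.Surjective f ∧ IsFiniteDimensionalVectorGroup k f.ker) :
    ∃ f : H →* Q, Function.Surjective f ∧ IsFiniteDimensionalVectorGroup k f.ker := by
  obtain ⟨f, hf, hk⟩ := h
  refine ⟨f.comp e.toMonoidHom, hf.comp e.surjective, hk.of_mulEquiv ?_⟩
  refine MulEquiv.ofBijective ((e.toMonoidHom.comp (Subgroup.subtype _)).codRestrict f.ker
    fun x => x.2) ⟨fun x y hxy => ?_, fun x => ?_⟩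
  · exact Subtype.ext (e.injective (congrArg Subtype.val hxy))
  · obtain ⟨y, hy⟩ := e.surjective x.1
    exact ⟨⟨y, by rw [MonoidHom.mem_ker]; change f (e y) = 1; rw [hy]; exact x.2⟩, Subtype.ext hy⟩

/-- If `M₂(k)` is conjugate to `A` and `k` is not quadratically closed, then a companion matrix
gives an invertible element of `A` without eigenvalues in `k`. -/
lemma exists_no_root_of_full {A : Subalgebra k (Matrix (Fin 2) (Fin 2) K)}
    (hF : IsFullConstant A) (hk : ¬ QuadraticallyClosed k) :
    ∃ X ∈ A, X.det ≠ 0 ∧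
      ∀ c : k, algebraMap k K c ^ 2 - X.trace * algebraMap k K c + X.det ≠ 0 := by
  unfold QuadraticallyClosed at hk
  push Not at hk
  obtain ⟨p, hp, hroot⟩ := hk
  have hlead : p.coeff 2 ≠ 0 := by
    rw [← hp]
    exact leadingCoeff_ne_zero.2 (fun h => by simp [h] at hp)
  have heval : ∀ c : k, p.coeff 0 + p.coeff 1 * c + p.coeff 2 * c ^ 2 ≠ 0 := by
    intro c h
    apply hroot c
    rw [IsRoot.def, eval_eq_sum_range, hp]
    simp [Finset.sum_range_succ, h]
  have h0 : p.coeff 0 ≠ 0 := by simpa using heval 0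
  refine ⟨!![0, algebraMap k K (-(p.coeff 0 / p.coeff 2)); 1,
    algebraMap k K (-(p.coeff 1 / p.coeff 2))], ?_, ?_, ?_⟩
  · rw [hF]
    intro i j
    fin_cases i <;> fin_cases j
    · exact ⟨0, by simp⟩
    · exact ⟨_, rfl⟩
    · exact ⟨1, by simp⟩
    · exact ⟨_, rfl⟩
  · simp [det_fin_two, h0, hlead]
  · intro c h
    apply heval c
    rw [det_fin_two_of, trace_fin_two_of] at h
    have h2 : algebraMap k K (c ^ 2 + (p.coeff 1 / p.coeff 2) * c + p.coeff 0 / p.coeff 2) = 0 := by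
      rw [← h]
      simp
    have h3 := (map_eq_zero_iff _ (algebraMap k K).injective).1 h2
    field_simp at h3
    linear_combination h3

lemma det_sub_smul_one (X : Matrix (Fin 2) (Fin 2) K) (c : K) :
    (X - c • (1 : Matrix (Fin 2) (Fin 2) K)).det = X.det - X.trace * c + c ^ 2 := by
  simp [det_fin_two, trace_fin_two]
  ring

lemma trace_sub_smul_one (X : Matrix (Fin 2) (Fin 2) K) (c : K) :
    (X - c • (1 : Matrix (Fin 2) (Fin 2) K)).trace = X.trace - 2 * c := by
  simp [trace_fin_two]
  ring

/-- The unit group of an algebra in which all units have eigenvalues in `k` and some unit has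
distinct eigenvalues. -/
lemma HasConstantCharpolys.units_of_split {A : Subalgebra k (Matrix (Fin 2) (Fin 2) K)}
    (hA : HasConstantCharpolys A) [FiniteDimensional k A] (hk : ¬ QuadraticallyClosed k)
    (hsplit : ∀ X ∈ A, X.det ≠ 0 → ∃ a b : k,
      X.trace = algebraMap k K (a + b) ∧ X.det = algebraMap k K (a * b))
    (hdist : ∃ X ∈ A, X.det ≠ 0 ∧ X.trace ^ 2 - 4 * X.det ≠ 0) :
    ∃ f : Aˣ →* kˣ × kˣ, Function.Surjective f ∧ IsFiniteDimensionalVectorGroup k f.ker := by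
  obtain ⟨X, hX, hd, hdisc⟩ := hdist
  obtain ⟨a, b, ht, hdet⟩ := hsplit X hX hd
  rw [ht, hdet] at hdisc
  have hab : algebraMap k K a - algebraMap k K b ≠ 0 := by
    intro h
    apply hdisc
    simp only [map_add, map_mul]
    linear_combination (algebraMap k K a - algebraMap k K b) * h
  -- the spectral projection of `X` for the eigenvalue `a`
  have he := algebraMap_smul_mem (a - b)⁻¹
    (A.sub_mem hX (algebraMap_smul_mem b A.one_mem))
  obtain ⟨φ, hφ, hT | hF⟩ := hA.triangular_or_full he
    (by
      rw [det_smul, det_sub_smul_one, ht, hdet]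
      simp only [map_add, map_mul]
      ring)
    (by
      rw [trace_smul, trace_sub_smul_one, ht, map_inv₀, map_sub, smul_eq_mul]
      simp only [map_add]
      field_simp
      ring)
  · have : FiniteDimensional k (A.map φ.toAlgHom) :=
      (AlgEquiv.subalgebraMap φ A).toLinearEquiv.finiteDimensional
    exact exists_hom_comp (unitsMapEquiv A φ) (hT.exists_hom (hA.map hφ))
  · obtain ⟨_, ⟨Y, hY, rfl⟩, hYd, hY0⟩ := exists_no_root_of_full hF hk
    have hp := hφ Y
    change (φ Y).det ≠ 0 at hYd
    change ∀ c : k, _ ^ 2 - (φ Y).trace * _ + (φ Y).det ≠ 0 at hY0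
    rw [hp.2] at hYd hY0
    rw [hp.1] at hY0
    obtain ⟨α, β, h1, h2⟩ := hsplit Y hY hYd
    refine (hY0 α ?_).elim
    rw [h1, h2]
    simp only [map_add, map_mul]
    ring

lemma mul_eq_zero_of_nilpotent {n m : Matrix (Fin 2) (Fin 2) K} (hn : n.trace = 0)
    (hn' : n.det = 0) (hm : m.trace = 0) (hm' : m.det = 0) (h : (n * m).trace = 0) :
    n * m = 0 := by
  simp only [trace_fin_two, det_fin_two, mul_apply, Fin.sum_univ_two] at *
  have hn1 : n 1 1 = -n 0 0 := by linear_combination hn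
  have hm1 : m 1 1 = -m 0 0 := by linear_combination hm
  rw [hn1] at hn' h
  rw [hm1] at hm' h
  ext i j
  simp only [mul_apply, Fin.sum_univ_two, Matrix.zero_apply]
  apply pow_eq_zero_iff (two_ne_zero) |>.1
  fin_cases i <;> fin_cases j <;> simp only [Fin.zero_eta, Fin.mk_one, hn1, hm1]
  · linear_combination (n 0 1 * m 1 0) * h + hn' * m 0 1 * m 1 0 - hm' * n 0 0 ^ 2
  · linear_combination (-n 0 1 * m 0 1) * h - m 0 1 ^ 2 * hn' - n 0 1 ^ 2 * hm'
  · linear_combination (-n 1 0 * m 1 0) * h - m 1 0 ^ 2 * hn' - n 1 0 ^ 2 * hm'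
  · linear_combination (n 1 0 * m 0 1) * h + hn' * m 0 1 * m 1 0 - hm' * n 0 0 ^ 2

end

/-! ### Unit groups when all eigenvalues are repeated constants -/

section

open Matrix

variable {k : Type u} {K : Type v} [Field k] [Field K] [Algebra k K]

lemma det_one_add (n : Matrix (Fin 2) (Fin 2) K) : (1 + n).det = 1 + n.trace + n.det := by
  simp [det_fin_two, trace_fin_two]
  ring

lemma det_add_fin_two (n m : Matrix (Fin 2) (Fin 2) K) :
    (n + m).det = n.det + m.det + n.trace * m.trace - (n * m).trace := by
  simp [det_fin_two, trace_fin_two, mul_apply, Fin.sum_univ_two]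
  ring

/-- If all units of `A` have repeated eigenvalues then nilpotent elements of `A` annihilate each
other: otherwise `(1 + n) * (1 + m)` or `(1 + n) * (1 - m)` would have distinct eigenvalues. -/
lemma mul_eq_zero_of_repeated {A : Subalgebra k (Matrix (Fin 2) (Fin 2) K)}
    (hrep : ∀ X ∈ A, X.det ≠ 0 → X.trace ^ 2 - 4 * X.det = 0)
    {n m : Matrix (Fin 2) (Fin 2) K} (hn : n ∈ A) (hm : m ∈ A) (hnt : n.trace = 0)
    (hnd : n.det = 0) (hmt : m.trace = 0) (hmd : m.det = 0) : n * m = 0 := by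
  apply mul_eq_zero_of_nilpotent hnt hnd hmt hmd
  have key : ∀ m' ∈ A, m'.trace = 0 → m'.det = 0 →
      (2 + (n * m').trace) ^ 2 - 4 = 0 := by
    intro m' hm' ht hd
    have hdet : ((1 + n) * (1 + m')).det = 1 := by
      rw [det_mul, det_one_add, det_one_add, hnt, hnd, ht, hd]
      ring
    have htr : ((1 + n) * (1 + m')).trace = 2 + (n * m').trace := by
      rw [mul_add, mul_one, add_mul, one_mul, trace_add, trace_add, trace_add, hnt, ht]
      simp
    have := hrep _ (A.mul_mem (A.add_mem A.one_mem hn) (A.add_mem A.one_mem hm'))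
      (by rw [hdet]; exact one_ne_zero)
    rwa [hdet, htr, mul_one] at this
  have h1 := key m hm hmt hmd
  have h2 := key (-m) (A.neg_mem hm) (by rw [trace_neg, hmt, neg_zero])
    (by simpa [det_fin_two] using hmd)
  rw [mul_neg, trace_neg] at h2
  have h3 : (2 : K) ^ 3 * (n * m).trace = 0 := by linear_combination h1 - h2
  rcases mul_eq_zero.1 h3 with h | h
  · have h' : (2 : K) = 0 := pow_eq_zero_iff (three_ne_zero) |>.1 h
    refine pow_eq_zero_iff (two_ne_zero) |>.1 (?_ : (n * m).trace ^ 2 = 0)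
    linear_combination h1 - 2 * (n * m).trace * h'
  · exact h

/-- The unit group of an algebra in which all units have repeated eigenvalues lying in `k`: the
unipotent matrices form a vector group `1 + V`, where `V` is the space of nilpotent matrices in
`A`, and every unit is a scalar multiple of one of them. -/
lemma HasConstantCharpolys.units_of_repeated {A : Subalgebra k (Matrix (Fin 2) (Fin 2) K)}
    (hA : HasConstantCharpolys A) [FiniteDimensional k A]
    (hrep : ∀ X ∈ A, X.det ≠ 0 → ∃ c : k,
      X.trace = algebraMap k K (c + c) ∧ X.det = algebraMap k K (c * c)) :
    ∃ N : Subgroup Aˣ, IsFiniteDimensionalVectorGroup k N ∧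
      (∀ g ∈ N, ∀ c : K, (g : A).1 = c • 1 → g = 1) ∧
      ∀ g : Aˣ, ∃ c : k, c ≠ 0 ∧ ∃ n ∈ N, (g : A).1 = algebraMap k K c • (n : A).1 := by
  have hrep' : ∀ X ∈ A, X.det ≠ 0 → X.trace ^ 2 - 4 * X.det = 0 := by
    intro X hX hd
    obtain ⟨c, h1, h2⟩ := hrep X hX hd
    rw [h1, h2]
    simp only [map_add, map_mul]
    ring
  -- the nilpotent part of a unipotent matrix
  have hnil : ∀ X : Matrix (Fin 2) (Fin 2) K, X.trace = 2 → X.det = 1 →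
      (X - 1).trace = 0 ∧ (X - 1).det = 0 := by
    intro X h1 h2
    have ht := trace_sub_smul_one X 1
    have hd := det_sub_smul_one X 1
    rw [one_smul] at ht hd
    rw [ht, hd, h1, h2]
    constructor <;> ring
  have hmul : ∀ X ∈ A, ∀ Y ∈ A, X.trace = 2 → X.det = 1 → Y.trace = 2 → Y.det = 1 →
      X * Y - 1 = (X - 1) + (Y - 1) := by
    intro X hX Y hY h1 h2 h3 h4
    have := mul_eq_zero_of_repeated hrep' (A.sub_mem hX A.one_mem) (A.sub_mem hY A.one_mem)
      (hnil X h1 h2).1 (hnil X h1 h2).2 (hnil Y h3 h4).1 (hnil Y h3 h4).2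
    calc X * Y - 1 = (X - 1) * (Y - 1) + ((X - 1) + (Y - 1)) := by noncomm_ring
      _ = _ := by rw [this, zero_add]
  let N : Subgroup Aˣ :=
    { carrier := {g | (g : A).1.trace = 2 ∧ (g : A).1.det = 1}
      mul_mem' := fun {g h} hg hh => by
        have e := hmul _ (g : A).2 _ (h : A).2 hg.1 hg.2 hh.1 hh.2
        refine ⟨?_, ?_⟩
        · have h1 : ((g : A).1 * (h : A).1).trace - 2 = 0 := by
            have := congrArg Matrix.trace e
            rw [trace_add, (hnil _ hg.1 hg.2).1, (hnil _ hh.1 hh.2).1, trace_sub] at this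
            simpa using this
          exact sub_eq_zero.1 h1
        · change ((g : A).1 * (h : A).1).det = 1
          rw [det_mul, hg.2, hh.2, one_mul]
      one_mem' := by
        constructor
        · change (1 : Matrix (Fin 2) (Fin 2) K).trace = 2
          simp
        · exact det_one
      inv_mem' := fun {g} hg => by
        have h1 : (g : A).1 * (↑g⁻¹ : A).1 = 1 := congrArg Subtype.val (Units.mul_inv g)
        have hd : (↑g⁻¹ : A).1.det = 1 := by
          have := congrArg Matrix.det h1
          rwa [det_mul, hg.2, one_mul, det_one] at this
        refine ⟨?_, hd⟩
        have h2 := sq_eq_trace_smul_sub_det (g : A).1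
        rw [hg.1, hg.2, one_smul] at h2
        have h3 := congrArg (· * (↑g⁻¹ : A).1) h2
        simp only [sub_mul, mul_assoc, smul_mul_assoc, h1, mul_one, one_mul] at h3
        have h4 := congrArg Matrix.trace h3
        rw [hg.1, trace_sub, trace_smul, trace_one] at h4
        simp only [Fintype.card_fin, smul_eq_mul, Nat.cast_ofNat] at h4
        linear_combination h4 }
  have hN : ∀ g : Aˣ, g ∈ N ↔ (g : A).1.trace = 2 ∧ (g : A).1.det = 1 := fun g => Iff.rfl
  let V : Submodule k A :=
    { carrier := {n | n.1.trace = 0 ∧ n.1.det = 0}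
      add_mem' := fun {n m} hn hm => by
        refine ⟨?_, ?_⟩
        · change (n.1 + m.1).trace = 0
          rw [trace_add, hn.1, hm.1, add_zero]
        · change (n.1 + m.1).det = 0
          rw [det_add_fin_two, mul_eq_zero_of_repeated hrep' n.2 m.2 hn.1 hn.2 hm.1 hm.2, hn.1,
            hn.2, hm.2]
          simp
      zero_mem' := by
        constructor
        · exact trace_zero _ _
        · exact det_zero
      smul_mem' := fun c n hn => by
        constructor
        · change (c • n.1).trace = 0
          rw [trace_smul, hn.1, smul_zero]
        · change (c • n.1).det = 0
          rw [← algebraMap_smul K c n.1, det_smul, hn.2, mul_zero] }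
  refine ⟨N, ⟨V, inferInstance, inferInstance, inferInstance, ⟨?_⟩⟩, ?_, ?_⟩
  · refine MulEquiv.ofBijective
      (MonoidHom.mk' (fun g => Multiplicative.ofAdd
        (⟨(g.1 : A) - 1, hnil _ g.2.1 g.2.2⟩ : V)) ?_) ⟨?_, ?_⟩
    · intro g h
      exact congrArg Multiplicative.ofAdd (Subtype.ext (Subtype.ext
        (hmul _ (g.1 : A).2 _ (h.1 : A).2 g.2.1 g.2.2 h.2.1 h.2.2)))
    · intro g h hgh
      have h1 : (g.1 : A) - 1 = (h.1 : A) - 1 := congrArg (fun x => (x.toAdd : V).1) hgh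
      exact Subtype.ext (Units.ext (sub_left_injective h1))
    · intro x
      have hx : x.toAdd.1.1.trace = 0 ∧ x.toAdd.1.1.det = 0 := x.toAdd.2
      have hmem := A.add_mem A.one_mem x.toAdd.1.2
      have hd : (1 + x.toAdd.1.1).det = 1 := by rw [det_one_add, hx.1, hx.2]; ring
      refine ⟨⟨hA.unit hmem (by rw [hd]; exact one_ne_zero), ?_, hd⟩, ?_⟩
      · change (1 + x.toAdd.1.1).trace = 2
        rw [trace_add, hx.1]
        simp
      · refine congrArg Multiplicative.ofAdd (Subtype.ext (Subtype.ext ?_))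
        change 1 + x.toAdd.1.1 - 1 = _
        rw [add_sub_cancel_left]
        rfl
  · intro g hg c hc
    rw [hN, hc] at hg
    have h1 : c = 1 := by
      have ht := hg.1
      have hd := hg.2
      rw [trace_smul, trace_one] at ht
      rw [det_smul, det_one] at hd
      simp only [Fintype.card_fin, smul_eq_mul, Nat.cast_ofNat, mul_one] at ht hd
      refine sub_eq_zero.1 (pow_eq_zero_iff (two_ne_zero) |>.1 (?_ : (c - 1) ^ 2 = 0))
      linear_combination hd - ht
    rw [h1, one_smul] at hc
    exact Units.ext (Subtype.ext hc)
  · intro g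
    obtain ⟨c, h1, h2⟩ := hrep _ (g : A).2 (det_ne_zero_of_unit g)
    have hc : c ≠ 0 := by
      rintro rfl
      exact det_ne_zero_of_unit g (by simpa using h2)
    have hcK : algebraMap k K c ≠ 0 := (_root_.map_ne_zero _).2 hc
    have hmem := algebraMap_smul_mem c⁻¹ (g : A).2
    have hd : (algebraMap k K c⁻¹ • (g : A).1).det = 1 := by
      rw [det_smul, h2, map_inv₀, map_mul, Fintype.card_fin]
      field_simp
    refine ⟨c, hc, hA.unit hmem (by rw [hd]; exact one_ne_zero), (hN _).2 ⟨?_, hd⟩, ?_⟩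
    · change (algebraMap k K c⁻¹ • (g : A).1).trace = 2
      rw [trace_smul, h1, map_inv₀, map_add, smul_eq_mul]
      field_simp
      ring
    · change _ = algebraMap k K c • algebraMap k K c⁻¹ • (g : A).1
      rw [smul_smul, map_inv₀, mul_inv_cancel₀ hcK, one_smul]

end

/-! ### Algebras containing a matrix without eigenvalues in `K` -/

section

open Matrix

variable {k : Type u} {K : Type v} [Field k] [Field K] [Algebra k K]

/-- Eigenvalues in `K` of an element of `A` are algebraic over `k`, hence constants. -/
lemma HasConstantCharpolys.root_mem {A : Subalgebra k (Matrix (Fin 2) (Fin 2) K)}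
    (hA : HasConstantCharpolys A) (hc : ∀ x : K, IsAlgebraic k x → ∃ c : k, algebraMap k K c = x)
    {X : Matrix (Fin 2) (Fin 2) K} (hX : X ∈ A) {y : K} (hy : y ^ 2 - X.trace * y + X.det = 0) :
    ∃ c : k, algebraMap k K c = y := by
  obtain ⟨⟨t, ht⟩, d, hd⟩ := hA X hX
  refine hc y ⟨(Polynomial.X ^ 2 - C t * Polynomial.X + C d : k[X]), ?_, ?_⟩
  · intro h
    have := congrArg (fun p : k[X] => p.coeff 2) h
    simp at this
  · simp [ht, hd, hy]

lemma HasConstantCharpolys.no_root {A : Subalgebra k (Matrix (Fin 2) (Fin 2) K)}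
    (hA : HasConstantCharpolys A) (hc : ∀ x : K, IsAlgebraic k x → ∃ c : k, algebraMap k K c = x)
    {X : Matrix (Fin 2) (Fin 2) K} (hX : X ∈ A)
    (hr : ∀ c : k, algebraMap k K c ^ 2 - X.trace * algebraMap k K c + X.det ≠ 0) (y : K) :
    y ^ 2 - X.trace * y + X.det ≠ 0 := by
  intro h
  obtain ⟨c, rfl⟩ := hA.root_mem hc hX h
  exact hr c h

/-- A nonzero nilpotent `X` with `tr (w * X) = 0` has a kernel vector that is an eigenvector of
`w`. -/
lemma eq_zero_of_trace_mul_eq_zero {w X : Matrix (Fin 2) (Fin 2) K}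
    (hw : ∀ y : K, y ^ 2 - w.trace * y + w.det ≠ 0) (hd : X.det = 0) (ht : X.trace = 0)
    (h : (w * X).trace = 0) : X = 0 := by
  simp only [trace_fin_two, det_fin_two, mul_apply, Fin.sum_univ_two] at hw hd ht h
  have h11 : X 1 1 = -X 0 0 := by linear_combination ht
  rw [h11] at hd h
  by_cases hb : X 0 1 = 0
  · have ha : X 0 0 = 0 := by
      rw [hb] at hd
      refine pow_eq_zero_iff (two_ne_zero) |>.1 (?_ : X 0 0 ^ 2 = 0)
      linear_combination -hd
    have hcc : X 1 0 = 0 := by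
      by_contra hcc
      rw [hb, ha] at h
      have hq : w 0 1 = 0 := by
        have : w 0 1 * X 1 0 = 0 := by linear_combination h
        exact (mul_eq_zero.1 this).resolve_right hcc
      apply hw (w 1 1)
      linear_combination -w 1 0 * hq
    ext i j
    fin_cases i <;> fin_cases j <;> simp [ha, hb, hcc, h11]
  · refine (hw ((w 0 0 * X 0 1 - w 0 1 * X 0 0) / X 0 1) ?_).elim
    field_simp
    linear_combination (-w 0 1 * X 0 1) * h - w 0 1 ^ 2 * hd

/-- An algebra with constant characteristic polynomials that contains a matrix without eigenvalues
in `K` is either a conjugate of `M₂(k)` or a division algebra. -/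
lemma HasConstantCharpolys.full_or_division {A : Subalgebra k (Matrix (Fin 2) (Fin 2) K)}
    (hA : HasConstantCharpolys A) {w : Matrix (Fin 2) (Fin 2) K} (hwA : w ∈ A)
    (hw : ∀ y : K, y ^ 2 - w.trace * y + w.det ≠ 0) :
    (∃ φ : Matrix (Fin 2) (Fin 2) K ≃ₐ[k] Matrix (Fin 2) (Fin 2) K, PreservesCharpoly φ ∧
      IsFullConstant (A.map φ.toAlgHom)) ∨ ∀ X ∈ A, X ≠ 0 → X.det ≠ 0 := by
  by_cases h : ∀ X ∈ A, X.det = 0 → X.trace = 0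
  · right
    intro X hX hX0 hd
    refine hX0 (eq_zero_of_trace_mul_eq_zero hw hd (h X hX hd) ?_)
    exact h _ (A.mul_mem hwA hX) (by rw [det_mul, hd, mul_zero])
  · left
    push Not at h
    obtain ⟨X, hX, hd, ht⟩ := h
    obtain ⟨⟨t, htt⟩, -⟩ := hA X hX
    have he := algebraMap_smul_mem t⁻¹ hX
    obtain ⟨φ, hφ, hT | hF⟩ := hA.triangular_or_full he (by rw [det_smul, hd, mul_zero])
      (by rw [trace_smul, map_inv₀, htt, smul_eq_mul, inv_mul_cancel₀ ht])
    · have h10 : φ w 1 0 = 0 := hT.2 _ ⟨w, hwA, rfl⟩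
      refine (hw (φ w 0 0) ?_).elim
      rw [← (hφ w).1, ← (hφ w).2, trace_fin_two, det_fin_two, h10]
      ring
    · exact ⟨φ, hφ, hF⟩

/-- The units of a conjugate of `M₂(k)`. -/
lemma IsFullConstant.nonempty_mulEquiv {A : Subalgebra k (Matrix (Fin 2) (Fin 2) K)}
    {φ : Matrix (Fin 2) (Fin 2) K ≃ₐ[k] Matrix (Fin 2) (Fin 2) K}
    (hF : IsFullConstant (A.map φ.toAlgHom)) : Nonempty (Aˣ ≃* GL (Fin 2) k) := by
  let f : Matrix (Fin 2) (Fin 2) k →ₐ[k] A.map φ.toAlgHom :=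
    (Algebra.ofId k K).mapMatrix.codRestrict _ fun Y => (hF _).2 fun i j => ⟨Y i j, rfl⟩
  have hf : Function.Bijective f := by
    constructor
    · intro X Y h
      ext i j
      exact (algebraMap k K).injective (congrFun (congrFun (congrArg Subtype.val h) i) j)
    · intro Z
      choose g hg using (hF _).1 Z.2
      exact ⟨Matrix.of g, Subtype.ext (by ext i j; exact hg i j)⟩
  exact ⟨(unitsMapEquiv A φ).trans (Units.mapEquiv (AlgEquiv.ofBijective f hf).toMulEquiv.symm)⟩

lemma HasConstantCharpolys.isUnit_or_eq_zero {A : Subalgebra k (Matrix (Fin 2) (Fin 2) K)}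
    (hA : HasConstantCharpolys A) (hdiv : ∀ X ∈ A, X ≠ 0 → X.det ≠ 0) (X : A) :
    IsUnit X ∨ X = 0 := by
  by_cases h : X = 0
  · exact Or.inr h
  · exact Or.inl ⟨hA.unit X.2 (hdiv _ X.2 fun h' => h (Subtype.ext h')), rfl⟩

end

/-! ### Quadratic fields and quaternion algebras -/

section

open Matrix

variable {k : Type u} {K : Type v} [Field k] [Field K] [Algebra k K]

lemma det_smul_one_add_smul (w : Matrix (Fin 2) (Fin 2) K) (p q : K) :
    (p • 1 + q • w).det = p ^ 2 + p * q * w.trace + q ^ 2 * w.det := by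
  simp [det_fin_two, trace_fin_two]
  ring

/-- If `w` has no eigenvalue in `K` then `K[w]` is a field. -/
lemma eq_zero_of_det_eq_zero {w : Matrix (Fin 2) (Fin 2) K}
    (hw : ∀ y : K, y ^ 2 - w.trace * y + w.det ≠ 0) {p q : K}
    (h : (p • 1 + q • w).det = 0) : p = 0 ∧ q = 0 := by
  rw [det_smul_one_add_smul] at h
  have hq : q = 0 := by
    by_contra hq
    apply hw (-(p / q))
    field_simp
    linear_combination h
  refine ⟨?_, hq⟩
  rw [hq] at h
  refine pow_eq_zero_iff (two_ne_zero) |>.1 (?_ : p ^ 2 = 0)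
  linear_combination h

/-- The trace form of `k[w]` is nondegenerate when `w` is separable, so that `A ∩ K[w] = k[w]`. -/
lemma HasConstantCharpolys.coeff_mem {A : Subalgebra k (Matrix (Fin 2) (Fin 2) K)}
    (hA : HasConstantCharpolys A) {w a : Matrix (Fin 2) (Fin 2) K} (hwA : w ∈ A) (haA : a ∈ A)
    (hdisc : w.trace ^ 2 - 4 * w.det ≠ 0) {p q : K} (h : a = p • 1 + q • w) :
    ∃ c d : k, a = algebraMap k K c • 1 + algebraMap k K d • w := by
  obtain ⟨⟨t, ht⟩, n, hn⟩ := hA w hwA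
  obtain ⟨⟨s, hs⟩, -⟩ := hA a haA
  obtain ⟨⟨r, hr⟩, -⟩ := hA _ (A.mul_mem haA hwA)
  have hs' : algebraMap k K s = 2 * p + q * w.trace := by
    rw [hs, h, trace_add, trace_smul, trace_smul, trace_one]
    simp [mul_comm]
  have hr' : algebraMap k K r = p * w.trace + q * (w.trace ^ 2 - 2 * w.det) := by
    rw [hr, h, add_mul, smul_mul_assoc, one_mul, smul_mul_assoc, sq_eq_trace_smul_sub_det]
    simp only [trace_add, trace_smul, trace_sub, trace_one, smul_eq_mul, Fintype.card_fin,
      Nat.cast_ofNat]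
    ring
  refine ⟨(s * (t ^ 2 - 2 * n) - r * t) / (t ^ 2 - 4 * n), (2 * r - s * t) / (t ^ 2 - 4 * n), ?_⟩
  have e1 : algebraMap k K ((s * (t ^ 2 - 2 * n) - r * t) / (t ^ 2 - 4 * n)) = p := by
    simp only [map_div₀, map_sub, map_mul, map_pow, map_ofNat, ht, hn]
    rw [div_eq_iff hdisc, hs', hr']
    ring
  have e2 : algebraMap k K ((2 * r - s * t) / (t ^ 2 - 4 * n)) = q := by
    simp only [map_div₀, map_sub, map_mul, map_pow, map_ofNat, ht, hn]
    rw [div_eq_iff hdisc, hs', hr']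
    ring
  rw [e1, e2, h]

/-- If `a` is not in `k[w]`, then `1, w, a, w * a` are linearly independent over `K`, since `K[w]`
is a field and meets `A` in `k[w]`. -/
lemma HasConstantCharpolys.linearIndependent {A : Subalgebra k (Matrix (Fin 2) (Fin 2) K)}
    (hA : HasConstantCharpolys A) {w a : Matrix (Fin 2) (Fin 2) K} (hwA : w ∈ A) (haA : a ∈ A)
    (hw : ∀ y : K, y ^ 2 - w.trace * y + w.det ≠ 0) (hdisc : w.trace ^ 2 - 4 * w.det ≠ 0)
    (ha : ¬ ∃ c d : k, a = algebraMap k K c • 1 + algebraMap k K d • w) :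
    LinearIndependent K ![1, w, a, w * a] := by
  rw [Fintype.linearIndependent_iff]
  intro x hx
  simp only [Fin.sum_univ_four, cons_val_zero, cons_val_one, cons_val] at hx
  have hy : (x 2 • 1 + x 3 • w) * a = -(x 0 • 1 + x 1 • w) := by
    rw [add_mul, smul_mul_assoc, one_mul, smul_mul_assoc, eq_neg_iff_add_eq_zero, ← hx]
    abel
  have h23 : x 2 = 0 ∧ x 3 = 0 := by
    by_contra hne
    have hd : (x 2 • 1 + x 3 • w).det ≠ 0 := fun h => hne (eq_zero_of_det_eq_zero hw h)
    apply ha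
    set y := x 2 • 1 + x 3 • w with hydef
    have hinv : (y.trace • 1 - y) * y = y.det • (1 : Matrix (Fin 2) (Fin 2) K) := by
      rw [sub_mul, smul_mul_assoc, one_mul, sq_eq_trace_smul_sub_det, sub_sub_cancel]
    have htr : y.trace = 2 * x 2 + x 3 * w.trace := by
      rw [hydef, trace_add, trace_smul, trace_smul, trace_one]
      simp [mul_comm]
    have h1 : y.det • a = (y.trace • 1 - y) * -(x 0 • 1 + x 1 • w) := by
      rw [← hy, ← mul_assoc, hinv, smul_mul_assoc, one_mul]
    have h2 : (y.trace • 1 - y) * -(x 0 • 1 + x 1 • w) =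
        (-((x 2 + x 3 * w.trace) * x 0) - x 3 * x 1 * w.det) • 1 +
          (x 3 * x 0 - x 2 * x 1) • w := by
      have e : y.trace • 1 - y = (x 2 + x 3 * w.trace) • 1 - x 3 • w := by
        rw [htr, hydef]
        module
      rw [e, mul_neg, sub_mul, mul_add, mul_add]
      simp only [smul_mul_assoc, mul_smul_comm, one_mul, mul_one, sq_eq_trace_smul_sub_det w]
      module
    refine hA.coeff_mem hwA haA hdisc
      (p := y.det⁻¹ * (-((x 2 + x 3 * w.trace) * x 0) - x 3 * x 1 * w.det))
      (q := y.det⁻¹ * (x 3 * x 0 - x 2 * x 1)) ?_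
    rw [mul_smul, mul_smul, ← smul_add, ← h2, ← h1, smul_smul, inv_mul_cancel₀ hd, one_smul]
  have h01 : x 0 = 0 ∧ x 1 = 0 := by
    refine eq_zero_of_det_eq_zero hw ?_
    rw [h23.1, h23.2] at hy
    rw [zero_smul, zero_smul, add_zero, zero_mul, eq_comm, neg_eq_zero] at hy
    rw [hy]
    exact det_zero
  intro i
  fin_cases i
  · exact h01.1
  · exact h01.2
  · exact h23.1
  · exact h23.2

/-- The trace of an element of `A`, as an element of `k`. -/
def HasConstantCharpolys.traceHom {A : Subalgebra k (Matrix (Fin 2) (Fin 2) K)}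
    (hA : HasConstantCharpolys A) : A →ₗ[k] k where
  toFun X := (hA X X.2).1.choose
  map_add' X Y := (algebraMap k K).injective <| by
    rw [map_add, (hA _ (X + Y).2).1.choose_spec, (hA _ X.2).1.choose_spec,
      (hA _ Y.2).1.choose_spec]
    exact trace_add _ _
  map_smul' c X := (algebraMap k K).injective <| by
    rw [smul_eq_mul, map_mul, RingHom.id_apply, (hA _ (c • X).2).1.choose_spec,
      (hA _ X.2).1.choose_spec, ← Algebra.smul_def]
    exact trace_smul _ _

lemma HasConstantCharpolys.algebraMap_traceHom {A : Subalgebra k (Matrix (Fin 2) (Fin 2) K)}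
    (hA : HasConstantCharpolys A) (X : A) : algebraMap k K (hA.traceHom X) = X.1.trace :=
  (hA X X.2).1.choose_spec

/-- If `A` contains a `K`-basis of `M₂(K)` then it has dimension `4`: the basis is linearly
independent over `k`, and an element is determined by the traces of its products with the basis
elements, which lie in `k`. -/
lemma HasConstantCharpolys.finrank_eq_four {A : Subalgebra k (Matrix (Fin 2) (Fin 2) K)}
    (hA : HasConstantCharpolys A) (b : Fin 4 → A)
    (hb : LinearIndependent K fun i => (b i).1) : Module.finrank k A = 4 := by
  have hspan := hb.span_eq_top_of_card_eq_finrank (by simp [Module.finrank_matrix])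
  let T : A →ₗ[k] (Fin 4 → k) :=
    LinearMap.pi fun i => hA.traceHom ∘ₗ LinearMap.mulRight k (b i)
  have hT : Function.Injective T := by
    rw [injective_iff_map_eq_zero]
    intro X hX
    have h1 : ∀ i, (X.1 * (b i).1).trace = 0 := by
      intro i
      have := congrFun hX i
      change hA.traceHom (X * b i) = 0 at this
      have h2 := hA.algebraMap_traceHom (X * b i)
      rw [this, map_zero] at h2
      exact h2.symm
    have h2 : ∀ Y : Matrix (Fin 2) (Fin 2) K, (X.1 * Y).trace = 0 := by
      intro Y
      have hY : Y ∈ Submodule.span K (Set.range fun i => (b i).1) := by rw [hspan]; trivial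
      induction hY using Submodule.span_induction with
      | mem x hx => obtain ⟨i, rfl⟩ := hx; exact h1 i
      | zero => simp
      | add x y _ _ hx hy => rw [mul_add, trace_add, hx, hy, add_zero]
      | smul c x _ hx => rw [mul_smul_comm, trace_smul, hx, smul_zero]
    refine Subtype.ext (Matrix.ext_iff_trace_mul_right.2 fun Y => ?_)
    rw [h2]
    simp
  have : Module.Finite k A := Module.Finite.of_injective T hT
  have hbk : LinearIndependent k b := by
    have h1 : LinearIndependent k fun i => (b i).1 :=
      hb.restrict_scalars (by
        intro x y h
        simpa [← Algebra.algebraMap_eq_smul_one] using h)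
    exact LinearIndependent.of_comp A.val.toLinearMap h1
  apply le_antisymm
  · simpa using LinearMap.finrank_le_finrank_of_injective hT
  · simpa using hbk.fintype_card_le_finrank

/-- If `A` contains a `K`-basis of `M₂(K)` then its centre consists of constants. -/
lemma HasConstantCharpolys.isCentral {A : Subalgebra k (Matrix (Fin 2) (Fin 2) K)}
    (hA : HasConstantCharpolys A) (hc : ∀ x : K, IsAlgebraic k x → ∃ c : k, algebraMap k K c = x)
    (b : Fin 4 → A) (hb : LinearIndependent K fun i => (b i).1) : Algebra.IsCentral k A := by
  have hspan := hb.span_eq_top_of_card_eq_finrank (by simp [Module.finrank_matrix])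
  refine ⟨fun X hX => ?_⟩
  rw [Subalgebra.mem_center_iff] at hX
  have h2 : ∀ Y : Matrix (Fin 2) (Fin 2) K, Y * X.1 = X.1 * Y := by
    intro Y
    have hY : Y ∈ Submodule.span K (Set.range fun i => (b i).1) := by rw [hspan]; trivial
    induction hY using Submodule.span_induction with
    | mem x hx => obtain ⟨i, rfl⟩ := hx; exact congrArg Subtype.val (hX (b i))
    | zero => simp
    | add x y _ _ hx hy => rw [mul_add, add_mul, hx, hy]
    | smul c x _ hx => rw [mul_smul_comm, smul_mul_assoc, hx]
  have e1 := h2 !![1, 0; 0, 0]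
  have e2 := h2 !![0, 1; 0, 0]
  have h01 : X.1 0 1 = 0 := by
    simpa [mul_apply, Fin.sum_univ_two, vecMul, dotProduct] using congrFun (congrFun e1 0) 1
  have h10 : X.1 1 0 = 0 := by
    simpa [mul_apply, Fin.sum_univ_two, vecMul, dotProduct] using (congrFun (congrFun e1 1) 0).symm
  have h11 : X.1 1 1 = X.1 0 0 := by
    simpa [mul_apply, Fin.sum_univ_two, vecMul, dotProduct] using congrFun (congrFun e2 0) 1
  obtain ⟨c, hcc⟩ := hA.root_mem hc X.2 (y := X.1 0 0) (by
    rw [trace_fin_two, det_fin_two, h01, h11]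
    ring)
  rw [Algebra.mem_bot]
  refine ⟨c, Subtype.ext ?_⟩
  rw [Subalgebra.coe_algebraMap, Algebra.algebraMap_eq_smul_one, ← algebraMap_smul K c]
  ext i j
  fin_cases i <;> fin_cases j <;> simp [hcc, h01, h10, h11]

/-- The unit group of an algebra that contains a unit with distinct eigenvalues not in `k`. -/
lemma HasConstantCharpolys.units_of_separable {A : Subalgebra k (Matrix (Fin 2) (Fin 2) K)}
    (hA : HasConstantCharpolys A) (hc : ∀ x : K, IsAlgebraic k x → ∃ c : k, algebraMap k K c = x)
    {w : Matrix (Fin 2) (Fin 2) K} (hwA : w ∈ A)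
    (hr : ∀ c : k, algebraMap k K c ^ 2 - w.trace * algebraMap k K c + w.det ≠ 0)
    (hdisc : w.trace ^ 2 - 4 * w.det ≠ 0) :
    (∃ (L : Type v) (_ : Field L) (_ : Algebra k L),
        Module.finrank k L = 2 ∧ Algebra.IsSeparable k L ∧ Nonempty (Aˣ ≃* Lˣ)) ∨
      Nonempty (Aˣ ≃* GL (Fin 2) k) ∨
      ∃ (Q : Type v) (_ : DivisionRing Q) (_ : Algebra k Q),
        Algebra.IsCentral k Q ∧ Module.finrank k Q = 4 ∧ Nonempty (Aˣ ≃* Qˣ) := by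
  have hw := hA.no_root hc hwA hr
  obtain ⟨φ, -, hF⟩ | hdiv := hA.full_or_division hwA hw
  · exact Or.inr (Or.inl hF.nonempty_mulEquiv)
  by_cases hspan : ∀ a ∈ A, ∃ c d : k, a = algebraMap k K c • 1 + algebraMap k K d • w
  · left
    let W : A := ⟨w, hwA⟩
    have hspan' : ∀ a : A, ∃ c d : k, a = c • (1 : A) + d • W := by
      intro a
      obtain ⟨c, d, h⟩ := hspan a a.2
      refine ⟨c, d, Subtype.ext ?_⟩
      simp only [algebraMap_smul] at h
      exact h
    let : CommRing A :=
      { (inferInstance : Ring A) with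
        mul_comm := fun a b => by
          obtain ⟨c, d, rfl⟩ := hspan' a
          obtain ⟨c', d', rfl⟩ := hspan' b
          simp only [mul_add, add_mul, smul_mul_assoc, mul_smul_comm, one_mul, mul_one]
          module }
    let : Field A := Field.ofIsUnitOrEqZero (hA.isUnit_or_eq_zero hdiv)
    refine ⟨A, inferInstance, inferInstance, ?_, ?_, ⟨MulEquiv.refl _⟩⟩
    · have hli : LinearIndependent k ![(1 : A), W] := by
        rw [LinearIndependent.pair_iff]
        intro s t hst
        have h1 : algebraMap k K s • 1 + algebraMap k K t • w = 0 := by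
          simp only [algebraMap_smul]
          exact congrArg Subtype.val hst
        have := eq_zero_of_det_eq_zero hw (p := algebraMap k K s) (q := algebraMap k K t)
          (by rw [h1]; exact det_zero)
        simpa using this
      have htop : ⊤ ≤ Submodule.span k (Set.range ![(1 : A), W]) := by
        intro a _
        obtain ⟨c, d, rfl⟩ := hspan' a
        exact Submodule.add_mem _ (Submodule.smul_mem _ _ (Submodule.subset_span ⟨0, rfl⟩))
          (Submodule.smul_mem _ _ (Submodule.subset_span ⟨1, rfl⟩))
      simpa using Module.finrank_eq_card_basis (Module.Basis.mk hli htop)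
    · have hW : IsSeparable k W := by
        obtain ⟨⟨t, ht⟩, n, hn⟩ := hA w hwA
        have hsep : (X ^ 2 - C t * X + C n : k[X]).Separable := by
          have hne : t ^ 2 - 4 * n ≠ 0 := by
            intro h
            apply hdisc
            rw [← ht, ← hn]
            rw [← map_pow, ← map_ofNat (algebraMap k K) 4, ← map_mul, ← map_sub, h, map_zero]
          refine ⟨C (-(4 / (t ^ 2 - 4 * n))), C (1 / (t ^ 2 - 4 * n)) * (2 * X - C t), ?_⟩
          have hd : derivative (X ^ 2 - C t * X + C n : k[X]) = 2 * X - C t := by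
            have hC : (C 2 : k[X]) = 2 := C_ofNat 2
            simp [one_add_one_eq_two, hC]
          rw [hd]
          have h4 : (C (t ^ 2 - 4 * n) : k[X]) * C (1 / (t ^ 2 - 4 * n)) = 1 := by
            rw [← C_mul, mul_one_div_cancel hne, C_1]
          have h5 : (C (-(4 / (t ^ 2 - 4 * n))) : k[X]) = -4 * C (1 / (t ^ 2 - 4 * n)) := by
            rw [← C_ofNat, ← C_neg, ← C_mul]
            ring_nf
          rw [h5, ← h4]
          simp only [C_sub, C_mul, C_pow, C_ofNat]
          ring
        refine hsep.of_dvd (minpoly.dvd k W (Subtype.ext ?_))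
        have := sq_eq_trace_smul_sub_det w
        rw [← ht, ← hn, algebraMap_smul, algebraMap_smul] at this
        have h6 : W ^ 2 = t • W - n • 1 := by
          rw [sq]
          exact Subtype.ext this
        simp only [aeval_def, eval₂_add, eval₂_sub, eval₂_mul, eval₂_pow, eval₂_X, eval₂_C]
        rw [h6, Algebra.smul_def, Algebra.smul_def]
        simp
      refine ⟨fun a => ?_⟩
      obtain ⟨c, d, rfl⟩ := hspan' a
      rw [← Algebra.algebraMap_eq_smul_one, Algebra.smul_def]
      exact Field.isSeparable_add (isSeparable_algebraMap _)
        (Field.isSeparable_mul (isSeparable_algebraMap _) hW)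
  · right; right
    push Not at hspan
    obtain ⟨a, haA, ha⟩ := hspan
    have hli := hA.linearIndependent hwA haA hw hdisc (by push Not; exact ha)
    let b : Fin 4 → A := ![1, ⟨w, hwA⟩, ⟨a, haA⟩, ⟨w * a, A.mul_mem hwA haA⟩]
    have hb : LinearIndependent K fun i => (b i).1 := by
      convert! hli using 1
      ext1 i
      fin_cases i <;> rfl
    let : DivisionRing A := DivisionRing.ofIsUnitOrEqZero (hA.isUnit_or_eq_zero hdiv)
    exact ⟨A, inferInstance, inferInstance, hA.isCentral hc b hb, hA.finrank_eq_four b hb,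
      ⟨MulEquiv.refl _⟩⟩

end

/-! ### The purely inseparable case -/

section

open Matrix

variable {k : Type u} {K : Type v} [Field k] [Field K] [Algebra k K]

lemma mul_add_mul_eq (X Y : Matrix (Fin 2) (Fin 2) K) :
    X * Y + Y * X = X.trace • Y + Y.trace • X +
      ((X * Y).trace - X.trace * Y.trace) • (1 : Matrix (Fin 2) (Fin 2) K) := by
  ext i j
  fin_cases i <;> fin_cases j <;>
    simp [mul_apply, Fin.sum_univ_two, trace_fin_two] <;> ring

/-- A matrix commuting with a matrix `Y` that has a nonzero lower left entry lies in `K[Y]`. -/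
lemma eq_smul_one_add_smul_of_commute {X Y : Matrix (Fin 2) (Fin 2) K} (hY : Y 1 0 ≠ 0)
    (h : X * Y = Y * X) :
    X = (X 0 0 - X 1 0 / Y 1 0 * Y 0 0) • 1 + (X 1 0 / Y 1 0) • Y := by
  have h00 := congrFun (congrFun h 0) 0
  have h10 := congrFun (congrFun h 1) 0
  simp only [mul_apply, Fin.sum_univ_two] at h00 h10
  ext i j
  fin_cases i <;> fin_cases j <;> simp <;> field_simp
  · linear_combination h00
  · linear_combination h10

lemma two_pow_pred_dvd {m d : ℕ} (hm : 1 ≤ m) (h : 2 ^ m ∣ d * 2) : 2 ^ (m - 1) ∣ d := by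
  obtain ⟨m, rfl⟩ := Nat.exists_eq_add_of_le' hm
  rw [pow_succ] at h
  exact Nat.dvd_of_mul_dvd_mul_right two_pos h

/-- Let `A` be a commutative division algebra of matrices with trace zero over a field of
characteristic two and let `O` be the valuation ring of a place with residue field `κ`. Choose
`Y ∈ A` whose lower left entry has maximal value. Then every element of `A` is `s + r Y` with
`s, r ∈ O`, and reducing `s` and `r` embeds `A` into an algebra `κ[T]/(T² - d)`. Hence the degree of
`A` divides twice the degree of the place. -/
lemma HasConstantCharpolys.finrank_dvd [CharP k 2]
    {A : Subalgebra k (Matrix (Fin 2) (Fin 2) K)}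
    (hA : HasConstantCharpolys A) [FiniteDimensional k A] (hdiv : ∀ X ∈ A, X ≠ 0 → X.det ≠ 0)
    (htr : ∀ X ∈ A, X.trace = 0) (hcomm : ∀ X ∈ A, ∀ Y ∈ A, X * Y = Y * X)
    {w : Matrix (Fin 2) (Fin 2) K} (hwA : w ∈ A) (hw10 : w 1 0 ≠ 0) (P : Place k K) :
    Module.finrank k A ∣ P.degree * 2 := by
  have h2 : (2 : K) = 0 := by
    rw [← map_ofNat (algebraMap k K) 2, CharTwo.two_eq_zero, map_zero]
  set v := P.ring.valuation with hv
  have hvk : ∀ c : k, v (algebraMap k K c) ≤ 1 := fun c =>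
    (P.ring.valuation_le_one_iff _).2 (P.algebraMap_mem c)
  obtain ⟨Y, hYA, hY10, hYmax⟩ : ∃ Y ∈ A, Y 1 0 ≠ 0 ∧ ∀ X ∈ A, v (X 1 0) ≤ v (Y 1 0) := by
    let b := Module.finBasis k A
    have : Nonempty A := ⟨0⟩
    have hsum : ∀ X (hX : X ∈ A), X 1 0 = ∑ i, algebraMap k K (b.repr ⟨X, hX⟩ i) * (b i).1 1 0 := by
      intro X hX
      have h1 := congrArg (fun Z : A => Z.1 1 0) (b.sum_repr ⟨X, hX⟩)
      refine h1.symm.trans ?_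
      simp only [AddSubmonoidClass.coe_finsetSum, Matrix.sum_apply]
      refine Finset.sum_congr rfl fun i _ => ?_
      rw [← Algebra.smul_def]
      rfl
    have : Nonempty (Fin (Module.finrank k A)) := by
      by_contra hne
      rw [not_nonempty_iff] at hne
      exact hw10 (by rw [hsum w hwA]; simp)
    obtain ⟨i, hi⟩ := Finite.exists_max fun i => v ((b i).1 1 0)
    have hmax : ∀ X ∈ A, v (X 1 0) ≤ v ((b i).1 1 0) := by
      intro X hX
      rw [hsum X hX]
      refine v.map_sum_le fun j _ => ?_
      rw [map_mul]
      exact (mul_le_mul' (hvk _) (hi j)).trans (one_mul _).le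
    refine ⟨(b i).1, (b i).2, fun h0 => ?_, hmax⟩
    have := hmax w hwA
    rw [h0, map_zero, le_zero_iff, map_eq_zero] at this
    exact hw10 this
  obtain ⟨-, n, hn⟩ := hA Y hYA
  have hYY : Y * Y = algebraMap k K (-n) • (1 : Matrix (Fin 2) (Fin 2) K) := by
    rw [sq_eq_trace_smul_sub_det, htr Y hYA, ← hn, map_neg, zero_smul, zero_sub, neg_smul]
  let r : A → K := fun X => X.1 1 0 / Y 1 0
  let s : A → K := fun X => X.1 0 0 - r X * Y 0 0
  have hX : ∀ X : A, X.1 = s X • 1 + r X • Y := fun X =>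
    eq_smul_one_add_smul_of_commute hY10 (hcomm _ X.2 _ hYA)
  -- uniqueness of the coordinates
  have huniq : ∀ (X : A) (p q : K), X.1 = p • 1 + q • Y → s X = p ∧ r X = q := by
    intro X p q h
    have hr : r X = q := by
      change X.1 1 0 / Y 1 0 = q
      rw [h]
      simp [hY10]
    refine ⟨?_, hr⟩
    change X.1 0 0 - r X * Y 0 0 = p
    rw [hr, h]
    simp
  have hrO : ∀ X, r X ∈ P.ring := fun X => by
    rw [← P.ring.valuation_le_one_iff]
    change v (X.1 1 0 / Y 1 0) ≤ 1
    rw [map_div₀]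
    exact div_le_one_of_le₀ (hYmax _ X.2) zero_le
  have hsO : ∀ X, s X ∈ P.ring := fun X => by
    obtain ⟨-, d, hd⟩ := hA X X.2
    have hsq : s X ^ 2 = algebraMap k K d + r X ^ 2 * algebraMap k K n := by
      have hdet : X.1.det = s X ^ 2 + s X * r X * Y.trace + r X ^ 2 * Y.det := by
        conv_lhs => rw [hX X]
        exact det_smul_one_add_smul Y _ _
      rw [hd, hn, hdet, htr Y hYA]
      linear_combination -r X ^ 2 * Y.det * h2
    have : s X ^ 2 ∈ P.ring := by
      rw [hsq]
      exact add_mem (P.algebraMap_mem d) (mul_mem (pow_mem (hrO X) 2) (P.algebraMap_mem n))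
    rw [← P.ring.valuation_le_one_iff, map_pow] at this
    rw [← P.ring.valuation_le_one_iff]
    exact (pow_le_one_iff two_ne_zero).1 this
  let κ := IsLocalRing.ResidueField P.ring
  let p : κ[X] := X ^ 2 - C (algebraMap k κ (-n))
  have hp : p.Monic := monic_X_pow_sub_C _ two_ne_zero
  let ρ : P.ring →+* AdjoinRoot p := (AdjoinRoot.of p).comp (IsLocalRing.residue P.ring)
  have hroot : AdjoinRoot.root p * AdjoinRoot.root p =
      ρ ⟨algebraMap k K (-n), P.algebraMap_mem _⟩ := by
    have := AdjoinRoot.eval₂_root p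
    simp only [p, eval₂_sub, eval₂_X_pow, eval₂_C] at this
    rw [← sq]
    exact sub_eq_zero.1 this
  let f : A →+* AdjoinRoot p :=
    { toFun := fun X => ρ ⟨s X, hsO X⟩ + ρ ⟨r X, hrO X⟩ * AdjoinRoot.root p
      map_one' := by
        obtain ⟨h1, h0⟩ := huniq 1 1 0 (by simp)
        have e1 : (⟨s 1, hsO 1⟩ : P.ring) = 1 := Subtype.ext h1
        have e0 : (⟨r 1, hrO 1⟩ : P.ring) = 0 := Subtype.ext h0
        rw [e1, e0]
        simp
      map_zero' := by
        obtain ⟨h1, h0⟩ := huniq 0 0 0 (by simp)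
        have e1 : (⟨s 0, hsO 0⟩ : P.ring) = 0 := Subtype.ext h1
        have e0 : (⟨r 0, hrO 0⟩ : P.ring) = 0 := Subtype.ext h0
        rw [e1, e0]
        simp
      map_add' := fun X Z => by
        obtain ⟨h1, h0⟩ := huniq (X + Z) (s X + s Z) (r X + r Z) (by
          change X.1 + Z.1 = _
          conv_lhs => rw [hX X, hX Z]
          module)
        have e1 : (⟨s (X + Z), hsO _⟩ : P.ring) = ⟨s X, hsO X⟩ + ⟨s Z, hsO Z⟩ := Subtype.ext h1
        have e0 : (⟨r (X + Z), hrO _⟩ : P.ring) = ⟨r X, hrO X⟩ + ⟨r Z, hrO Z⟩ := Subtype.ext h0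
        rw [e1, e0, map_add, map_add]
        ring
      map_mul' := fun X Z => by
        obtain ⟨h1, h0⟩ := huniq (X * Z) (s X * s Z + r X * r Z * algebraMap k K (-n))
          (s X * r Z + r X * s Z) (by
          change X.1 * Z.1 = _
          conv_lhs => rw [hX X, hX Z]
          simp only [add_mul, mul_add, smul_mul_assoc, mul_smul_comm, one_mul, mul_one, hYY]
          module)
        have e1 : (⟨s (X * Z), hsO _⟩ : P.ring) = ⟨s X, hsO X⟩ * ⟨s Z, hsO Z⟩ +
          ⟨r X, hrO X⟩ * ⟨r Z, hrO Z⟩ * ⟨algebraMap k K (-n), P.algebraMap_mem _⟩ := Subtype.ext h1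
        have e0 : (⟨r (X * Z), hrO _⟩ : P.ring) = ⟨s X, hsO X⟩ * ⟨r Z, hrO Z⟩ +
          ⟨r X, hrO X⟩ * ⟨s Z, hsO Z⟩ := Subtype.ext h0
        rw [e1, e0]
        simp only [map_add, map_mul]
        rw [← hroot]
        ring }
  let _ : CommRing A :=
    { (inferInstance : Ring A) with
      mul_comm := fun a b => Subtype.ext (hcomm _ a.2 _ b.2) }
  let _ : Field A := Field.ofIsUnitOrEqZero (hA.isUnit_or_eq_zero hdiv)
  let _ : Algebra A (AdjoinRoot p) := f.toAlgebra
  have : IsScalarTower k A (AdjoinRoot p) := IsScalarTower.of_algebraMap_eq fun c => by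
    obtain ⟨h1, h0⟩ := huniq (algebraMap k A c) (algebraMap k K c) 0 (by
      change algebraMap k (Matrix (Fin 2) (Fin 2) K) c = _
      rw [Algebra.algebraMap_eq_smul_one, algebraMap_smul, zero_smul, add_zero])
    have e1 : (⟨s (algebraMap k A c), hsO _⟩ : P.ring) = ⟨algebraMap k K c, P.algebraMap_mem c⟩ :=
      Subtype.ext h1
    have e0 : (⟨r (algebraMap k A c), hrO _⟩ : P.ring) = 0 := Subtype.ext h0
    change _ = ρ ⟨s (algebraMap k A c), hsO _⟩ + ρ ⟨r (algebraMap k A c), hrO _⟩ * AdjoinRoot.root p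
    rw [e1, e0, map_zero, zero_mul, add_zero]
    rfl
  have h3 : Module.finrank κ (AdjoinRoot p) = 2 := by
    rw [(AdjoinRoot.powerBasis' hp).finrank, AdjoinRoot.powerBasis'_dim]
    exact natDegree_X_pow_sub_C
  have h4 : Module.finrank k κ * Module.finrank κ (AdjoinRoot p) =
      Module.finrank k (AdjoinRoot p) :=
    Module.finrank_mul_finrank k κ (AdjoinRoot p)
  rw [h3] at h4
  change Module.finrank k A ∣ Module.finrank k κ * 2
  rw [h4, ← Module.finrank_mul_finrank k A (AdjoinRoot p)]
  exact dvd_mul_right _ _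

/-- The unit group of an algebra in which all units have repeated eigenvalues and some unit has
eigenvalues not in `k`. -/
lemma HasConstantCharpolys.units_of_inseparable {A : Subalgebra k (Matrix (Fin 2) (Fin 2) K)}
    (hA : HasConstantCharpolys A) [FiniteDimensional k A]
    (hc : ∀ x : K, IsAlgebraic k x → ∃ c : k, algebraMap k K c = x)
    (hrep : ∀ X ∈ A, X.det ≠ 0 → X.trace ^ 2 - 4 * X.det = 0)
    {w : Matrix (Fin 2) (Fin 2) K} (hwA : w ∈ A) (hwd : w.det ≠ 0)
    (hr : ∀ c : k, algebraMap k K c ^ 2 - w.trace * algebraMap k K c + w.det ≠ 0) :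
    CharP k 2 ∧
      ∃ (F : Type v) (_ : Field F) (_ : Algebra k F) (m : ℕ),
        1 ≤ m ∧ IsPurelyInseparable k F ∧ Module.finrank k F = 2 ^ m ∧
        Nonempty (Aˣ ≃* Fˣ) ∧ ∀ P' : Place k K, 2 ^ (m - 1) ∣ P'.degree := by
  have hw := hA.no_root hc hwA hr
  have h2 : (2 : K) = 0 := by
    by_contra h2
    apply hw (w.trace / 2)
    field_simp
    linear_combination -hrep w hwA hwd
  have hchar : CharP k 2 := CharTwo.of_one_ne_zero_of_two_eq_zero one_ne_zero
    ((algebraMap k K).injective (by rw [map_ofNat, map_zero, h2]))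
  refine ⟨hchar, ?_⟩
  have hdiv : ∀ X ∈ A, X ≠ 0 → X.det ≠ 0 := by
    obtain ⟨φ, hφ, hF⟩ | hdiv := hA.full_or_division hwA hw
    · -- `M₂(k)` contains a unit of trace `1`
      have hmem : !![(1 : K), 1; 1, 0] ∈ A.map φ.toAlgHom := by
        rw [hF]
        intro i j
        fin_cases i <;> fin_cases j
        · exact ⟨1, by simp⟩
        · exact ⟨1, by simp⟩
        · exact ⟨1, by simp⟩
        · exact ⟨0, by simp⟩
      obtain ⟨X, hX, hXe⟩ := hmem
      change φ X = _ at hXe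
      have hp := hφ X
      rw [hXe, trace_fin_two_of, det_fin_two_of] at hp
      have := hrep X hX (by rw [← hp.2]; simp)
      rw [← hp.1, ← hp.2] at this
      have h1 : (1 : K) = 0 := by linear_combination this - 2 * h2
      exact (one_ne_zero h1).elim
    · exact hdiv
  have htr : ∀ X ∈ A, X.trace = 0 := by
    intro X hX
    by_cases h0 : X = 0
    · rw [h0, trace_zero]
    · refine pow_eq_zero_iff (two_ne_zero) |>.1 (?_ : X.trace ^ 2 = 0)
      linear_combination hrep X hX (hdiv X hX h0) + 2 * X.det * h2
  have hcomm : ∀ X ∈ A, ∀ Y ∈ A, X * Y = Y * X := by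
    intro X hX Y hY
    have h := mul_add_mul_eq X Y
    rw [htr X hX, htr Y hY, htr _ (A.mul_mem hX hY)] at h
    have h' : X * Y + Y * X = 0 := by simpa using h
    have h'' : (2 : K) • (Y * X) = 0 := by rw [h2, zero_smul]
    rw [two_smul] at h''
    exact add_right_cancel (h'.trans h''.symm)
  have hw10 : w 1 0 ≠ 0 := by
    intro h10
    apply hw (w 0 0)
    rw [trace_fin_two, det_fin_two, h10]
    ring
  have hdvd := fun P => hA.finrank_dvd hdiv htr hcomm hwA hw10 P
  let _ : CommRing A :=
    { (inferInstance : Ring A) with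
      mul_comm := fun a b => Subtype.ext (hcomm _ a.2 _ b.2) }
  let _ : Field A := Field.ofIsUnitOrEqZero (hA.isUnit_or_eq_zero hdiv)
  have hpi : IsPurelyInseparable k A := by
    rw [isPurelyInseparable_iff_pow_mem k 2]
    intro X
    obtain ⟨-, d, hd⟩ := hA X X.2
    refine ⟨1, -d, Subtype.ext ?_⟩
    have := sq_eq_trace_smul_sub_det X.1
    rw [htr _ X.2, ← hd, zero_smul, zero_sub, algebraMap_smul, ← neg_smul,
      ← Algebra.algebraMap_eq_smul_one, ← sq] at this
    rw [pow_one]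
    exact this.symm
  obtain ⟨m, hm⟩ := IsPurelyInseparable.finrank_eq_pow k (E := A) 2
  have hm1 : 1 ≤ m := by
    by_contra hm0
    have hm0 : m = 0 := by omega
    rw [hm0, pow_zero] at hm
    obtain ⟨c, hcw⟩ : (⟨w, hwA⟩ : A) ∈ (⊥ : Subalgebra k A) := by
      rw [Subalgebra.bot_eq_top_of_finrank_eq_one hm]
      trivial
    have hcw' : algebraMap k (Matrix (Fin 2) (Fin 2) K) c = w := congrArg Subtype.val hcw
    apply hw10
    rw [← hcw', Algebra.algebraMap_eq_smul_one]
    simp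
  refine ⟨A, inferInstance, inferInstance, m, hm1, hpi, hm, ⟨MulEquiv.refl _⟩, fun P => ?_⟩
  exact two_pow_pred_dvd hm1 (hm ▸ hdvd P)

end

/-! ### Finiteness of spaces of functions with bounded poles -/

section

variable {k : Type u} {K : Type v} [Field k] [Field K] [Algebra k K]

/-- An element of `K` that is integral at all places is a constant. -/
lemma IsFunctionFieldWithConstantField.exists_constant (hK : IsFunctionFieldWithConstantField k K)
    {y : K} (hy : ∀ P : Place k K, y ∈ P.ring) : ∃ c : k, algebraMap k K c = y := by
  apply hK.constants
  by_contra halg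
  have hmem : y ∉ (integralClosure k K).toSubring := fun h => halg (IsIntegral.isAlgebraic h)
  obtain ⟨V, hV, hyV⟩ := Subring.exists_le_valuationSubring_of_isIntegrallyClosedIn hmem
  exact hyV (hy ⟨V, fun c => hV ((integralClosure k K).algebraMap_mem c),
    fun h => hyV (h ▸ ValuationSubring.mem_top y)⟩)

open scoped IntermediateField.algebraAdjoinAdjoin in
/-- The function field is finite over `k(b)` for each nonconstant `b`. -/
lemma IsFunctionFieldWithConstantField.finiteDimensional
    (hK : IsFunctionFieldWithConstantField k K) {b : K} (hb : Transcendental k b) :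
    FiniteDimensional k⟮b⟯ K := by
  obtain ⟨x, hx, hfin⟩ := hK.finite_over_rational
  have halg : Algebra.IsAlgebraic (Algebra.adjoin k {x}) K :=
    (IsFractionRing.comap_isAlgebraic_iff (A := Algebra.adjoin k {x}) (K := k⟮x⟯)).2 inferInstance
  have htr : Algebra.trdeg k K ≤ 1 := by
    simpa using Algebra.IsAlgebraic.trdeg_le_cardinalMk k ({x} : Set K)
  have hind : AlgebraicIndependent k fun _ : Fin 1 => b :=
    algebraicIndependent_unique_type_iff.2 hb
  have hbasis : IsTranscendenceBasis k fun _ : Fin 1 => b :=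
    hind.isTranscendenceBasis_of_lift_trdeg_le_of_finite (by simpa using htr)
  have : Algebra.IsAlgebraic k⟮b⟯ K := by
    have := hbasis.isAlgebraic_field
    rwa [Set.range_const] at this
  have h1 : Algebra.EssFiniteType k k⟮x⟯ :=
    essFiniteType_iff.2 (fg_adjoin_of_finite (Set.finite_singleton x))
  have h2 : Algebra.EssFiniteType k K := .comp k k⟮x⟯ K
  have h3 : Algebra.EssFiniteType k⟮b⟯ K := .of_comp k k⟮b⟯ K
  exact Algebra.finite_of_essFiniteType_of_isAlgebraic

lemma Place.aeval_mem (P : Place k K) {b : K} (hb : b ∈ P.ring) (p : k[X]) :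
    aeval b p ∈ P.ring := by
  induction p using Polynomial.induction_on' with
  | add p q hp hq => rw [map_add]; exact add_mem hp hq
  | monomial n a =>
    rw [aeval_monomial]
    exact mul_mem (P.algebraMap_mem a) (pow_mem hb n)

/-- Let `b` be integral at `P`. Elements of `b⁻¹ O_P` that are linearly independent over `k` modulo
`O_P` are linearly independent over `k[b]`: dividing a relation by a power of `b` gives one whose
constant coefficients do not all vanish, and these form a relation modulo `O_P`. -/
lemma Place.eq_zero_of_sum_aeval_mul_eq_zero (P : Place k K) {b : K} (hb : b ∈ P.ring) (hb0 : b ≠ 0)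
    {ι : Type*} [Fintype ι] (f : ι → K) (hf : ∀ i, b * f i ∈ P.ring)
    (hli : ∀ c : ι → k, ∑ i, algebraMap k K (c i) * f i ∈ P.ring → c = 0)
    (N : ℕ) (p : ι → k[X]) (hN : ∀ i, (p i).natDegree ≤ N) (hp : ∑ i, aeval b (p i) * f i = 0) :
    p = 0 := by
  induction N generalizing p with
  | zero =>
    have h : ∀ i, p i = C ((p i).coeff 0) := fun i => eq_C_of_natDegree_le_zero (hN i)
    have h0 := hli (fun i => (p i).coeff 0) (by
      convert! P.ring.zero_mem using 1
      rw [← hp]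
      refine Finset.sum_congr rfl fun i _ => ?_
      conv_rhs => rw [h i, aeval_C])
    ext1 i
    rw [h i, show (p i).coeff 0 = 0 from congrFun h0 i]
    simp
  | succ N ih =>
    have hdiv : ∀ i, aeval b (p i) =
        b * aeval b (p i).divX + algebraMap k K ((p i).coeff 0) := fun i => by
      have h := congrArg (aeval b) (X_mul_divX_add (p i))
      rw [map_add, map_mul, aeval_X, aeval_C] at h
      exact h.symm
    have h0 := hli (fun i => (p i).coeff 0) (by
      have : ∑ i, algebraMap k K ((p i).coeff 0) * f i =
          -∑ i, aeval b (p i).divX * (b * f i) := by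
        rw [eq_neg_iff_add_eq_zero, ← Finset.sum_add_distrib, ← hp]
        refine Finset.sum_congr rfl fun i _ => ?_
        rw [hdiv i]
        ring
      rw [this]
      exact neg_mem (sum_mem fun i _ => mul_mem (P.aeval_mem hb _) (hf i)))
    have h0' : ∀ i, (p i).coeff 0 = 0 := fun i => congrFun h0 i
    have hq := ih (fun i => (p i).divX) (fun i => by
      rw [natDegree_divX_eq_natDegree_tsub_one]
      have := hN i
      omega) (by
      have : b * ∑ i, aeval b (p i).divX * f i = 0 := by
        rw [Finset.mul_sum, ← hp]
        refine Finset.sum_congr rfl fun i _ => ?_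
        rw [hdiv i, h0' i, map_zero, add_zero, mul_assoc]
      exact (mul_eq_zero.1 this).resolve_left hb0)
    ext1 i
    have hqi : (p i).divX = 0 := congrFun hq i
    rw [← X_mul_divX_add (p i), hqi, h0' i]
    simp

open scoped IntermediateField.algebraAdjoinAdjoin in
lemma Place.linearIndependent (P : Place k K) {b : K} (hb : b ∈ P.ring) (hb0 : b ≠ 0)
    {ι : Type*} [Fintype ι] (f : ι → K) (hf : ∀ i, b * f i ∈ P.ring)
    (hli : ∀ c : ι → k, ∑ i, algebraMap k K (c i) * f i ∈ P.ring → c = 0) :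
    LinearIndependent k⟮b⟯ f := by
  rw [← LinearIndependent.iff_fractionRing (R := Algebra.adjoin k {b}),
    Fintype.linearIndependent_iff]
  intro r hr
  have hex : ∀ i, ∃ p : k[X], aeval b p = (r i : K) := by
    intro i
    exact (Algebra.adjoin_singleton_eq_range_aeval k b).le (r i).2
  choose p hp using hex
  have h0 := P.eq_zero_of_sum_aeval_mul_eq_zero hb hb0 f hf hli
    (Finset.univ.sup fun i => (p i).natDegree) p
    (fun i => Finset.le_sup (f := fun i => (p i).natDegree) (Finset.mem_univ i)) (by
      rw [← hr]
      refine Finset.sum_congr rfl fun i _ => ?_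
      rw [hp i, Algebra.smul_def]
      rfl)
  intro i
  refine Subtype.ext ?_
  rw [← hp i, show p i = 0 from congrFun h0 i]
  simp

/-- The elements of `K` that are integral outside `P` and lie in `b⁻¹ O_P`. -/
def Place.boundedPole (P : Place k K) (b : K) : Submodule k K where
  carrier := {f | f ∈ P.integralOutside ∧ b * f ∈ P.ring}
  add_mem' := fun {f g} hf hg => ⟨add_mem hf.1 hg.1, by rw [mul_add]; exact add_mem hf.2 hg.2⟩
  zero_mem' := ⟨zero_mem _, by rw [mul_zero]; exact zero_mem _⟩
  smul_mem' := fun c f hf => ⟨Subalgebra.smul_mem _ hf.1 c, by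
    rw [mul_smul_comm, Algebra.smul_def]
    exact mul_mem (P.algebraMap_mem c) hf.2⟩

/-- Poles of bounded order at `P` cut out a finite-dimensional space: modulo the constants, which
are the elements integral at `P` as well, its dimension is at most `[K : k(b)]`. -/
lemma IsFunctionFieldWithConstantField.finite_boundedPole
    (hK : IsFunctionFieldWithConstantField k K) (P : Place k K) {b : K} (hb0 : b ≠ 0)
    (hb : P.ring.valuation b < 1) : FiniteDimensional k (P.boundedPole b) := by
  have hbO : b ∈ P.ring := (P.ring.valuation_le_one_iff b).1 hb.le
  have htrans : Transcendental k b := by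
    intro halg
    obtain ⟨c, rfl⟩ := hK.constants b halg
    have hc0 : c ≠ 0 := fun h => hb0 (by rw [h, map_zero])
    have h1 : P.ring.valuation (algebraMap k K c⁻¹) ≤ 1 :=
      (P.ring.valuation_le_one_iff _).2 (P.algebraMap_mem _)
    have h2 : P.ring.valuation (algebraMap k K c * algebraMap k K c⁻¹) = 1 := by
      rw [← map_mul, mul_inv_cancel₀ hc0, map_one, map_one]
    rw [map_mul] at h2
    have h3 := mul_lt_one_of_lt_of_le hb h1
    exact h3.ne h2
  have hfin := hK.finiteDimensional htrans
  let O : Submodule k K :=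
    { carrier := P.ring
      add_mem' := fun h h' => add_mem h h'
      zero_mem' := zero_mem _
      smul_mem' := fun c f hf => by
        rw [Algebra.smul_def]
        exact mul_mem (P.algebraMap_mem c) hf }
  have hO : ∀ f, f ∈ O ↔ f ∈ P.ring := fun f => Iff.rfl
  let π : P.boundedPole b →ₗ[k] K ⧸ O := O.mkQ ∘ₗ (P.boundedPole b).subtype
  have hker : FiniteDimensional k (LinearMap.ker π) := by
    let g : k →ₗ[k] P.boundedPole b :=
      { toFun := fun c => ⟨algebraMap k K c, P.integralOutside.algebraMap_mem c,
          mul_mem hbO (P.algebraMap_mem c)⟩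
        map_add' := fun c d => Subtype.ext (map_add _ _ _)
        map_smul' := fun c d => Subtype.ext (by simp [Algebra.smul_def]) }
    have hle : LinearMap.ker π ≤ LinearMap.range g := by
      intro f hf
      have hf' : (f : K) ∈ O := by
        rw [← Submodule.Quotient.mk_eq_zero]
        exact hf
      obtain ⟨c, hc⟩ := hK.exists_constant (y := f) fun P' => by
        by_cases h : P' = P
        · rw [h]
          exact hf'
        · exact f.2.1 P' h
      exact ⟨c, Subtype.ext hc⟩
    exact Submodule.finiteDimensional_of_le hle
  have hrange : FiniteDimensional k (LinearMap.range π) := by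
    have hrank : Module.rank k (LinearMap.range π) ≤ Module.finrank k⟮b⟯ K := by
      refine rank_le fun s hs => ?_
      choose g hg using fun y : LinearMap.range π => y.2
      have hli := P.linearIndependent hbO hb0 (fun i : s => (g i : K)) (fun i => (g i).2.2) (by
        intro c hc
        have h0 : ∑ i : s, c i • (i : LinearMap.range π) = 0 := by
          refine Subtype.ext ?_
          rw [← hO, ← Submodule.Quotient.mk_eq_zero] at hc
          rw [AddSubmonoidClass.coe_finsetSum, Submodule.coe_zero, ← hc]
          change _ = O.mkQ _
          rw [map_sum]
          refine Finset.sum_congr rfl fun i _ => ?_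
          rw [← Algebra.smul_def, map_smul, Submodule.coe_smul, ← hg i]
          rfl
        ext1 i
        exact (Fintype.linearIndependent_iff.1 hs) c h0 i)
      simpa using hli.fintype_card_le_finrank
    exact Module.rank_lt_aleph0_iff.1 (hrank.trans_lt (Cardinal.natCast_lt_aleph0))
  have : FiniteDimensional k (P.boundedPole b ⧸ LinearMap.ker π) :=
    π.quotKerEquivRange.symm.finiteDimensional
  exact Module.Finite.of_submodule_quotient (LinearMap.ker π)

end

/-! ### Vertex stabilizers as unit groups -/

section

open Matrix

variable {k : Type u} {K : Type v} [Field k] [Field K] [Algebra k K]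

namespace Place

lemma valuation_toCompletion (P : Place k K) (y : K) :
    (Valued.v (P.toCompletion y) : P.ring.ValueGroup) = P.ring.valuation y :=
  Valued.valuedCompletion_apply _

lemma toCompletion_mem_iff (P : Place k K) (y : K) :
    P.toCompletion y ∈ P.completedRing ↔ y ∈ P.ring := by
  rw [← P.ring.valuation_le_one_iff, ← P.valuation_toCompletion]
  rfl

/-- The matrices over the ring of elements integral outside `P` that preserve the lattice spanned by
the columns of `g`. For `P = ∞` these are the endomorphisms of a vector bundle of rank two. -/
def vertexAlgebra (P : Place k K) (g : GL (Fin 2) P.Completion) :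
    Subalgebra k (Matrix (Fin 2) (Fin 2) K) where
  carrier := {X | (∀ i j, X i j ∈ P.integralOutside) ∧
    ∀ i j, ((g⁻¹).1 * X.map P.toCompletion * g.1) i j ∈ P.completedRing}
  mul_mem' := fun {X Y} hX hY => by
    refine ⟨fun i j => ?_, fun i j => ?_⟩
    · rw [mul_apply]
      exact sum_mem fun l _ => mul_mem (hX.1 i l) (hY.1 l j)
    · have e : (g⁻¹).1 * (X * Y).map P.toCompletion * g.1 =
          ((g⁻¹).1 * X.map P.toCompletion * g.1) * ((g⁻¹).1 * Y.map P.toCompletion * g.1) := by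
        have hg : g.1 * (g⁻¹).1 = 1 := by rw [← Units.val_mul, mul_inv_cancel]; rfl
        rw [Matrix.map_mul]
        simp only [← mul_assoc]
        simp only [mul_assoc _ g.1 (g⁻¹).1, hg, mul_one]
      rw [e, mul_apply]
      exact sum_mem fun l _ => mul_mem (hX.2 i l) (hY.2 l j)
  add_mem' := fun {X Y} hX hY => by
    refine ⟨fun i j => add_mem (hX.1 i j) (hY.1 i j), fun i j => ?_⟩
    rw [Matrix.map_add _ (map_add _), mul_add, add_mul]
    exact add_mem (hX.2 i j) (hY.2 i j)
  algebraMap_mem' := fun c => by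
    refine ⟨fun i j => ?_, fun i j => ?_⟩
    · rw [algebraMap_matrix_apply]
      split
      · exact P.integralOutside.algebraMap_mem c
      · exact zero_mem _
    · have hg : (g⁻¹).1 * g.1 = 1 := by rw [← Units.val_mul, inv_mul_cancel]; rfl
      have e : (algebraMap k (Matrix (Fin 2) (Fin 2) K) c).map P.toCompletion =
          P.toCompletion (algebraMap k K c) • 1 := by
        ext i j
        rw [map_apply, algebraMap_matrix_apply, Matrix.smul_apply, one_apply]
        split <;> simp
      rw [e, mul_smul_comm, mul_one, smul_mul_assoc, hg, Matrix.smul_apply, one_apply]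
      split
      · rw [smul_eq_mul, mul_one, toCompletion_mem_iff]
        exact P.algebraMap_mem c
      · rw [smul_zero]
        exact zero_mem _

lemma mem_vertexAlgebra {P : Place k K} {g : GL (Fin 2) P.Completion}
    {X : Matrix (Fin 2) (Fin 2) K} : X ∈ P.vertexAlgebra g ↔ (∀ i j, X i j ∈ P.integralOutside) ∧
    ∀ i j, ((g⁻¹).1 * X.map P.toCompletion * g.1) i j ∈ P.completedRing := Iff.rfl

end Place

/-- An element of the ring of elements integral outside `P` that is integral at `P` as well is
a constant. -/
lemma IsFunctionFieldWithConstantField.exists_constant_of_mem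
    (hK : IsFunctionFieldWithConstantField k K) (P : Place k K) {y : K}
    (h1 : y ∈ P.integralOutside) (h2 : y ∈ P.ring) : ∃ c : k, algebraMap k K c = y := by
  refine hK.exists_constant fun P' => ?_
  by_cases h : P' = P
  · rw [h]
    exact h2
  · exact h1 P' h

lemma det_mem_of_entries_mem {R S : Type*} [CommRing R] [SetLike S R] [SubringClass S R] (s : S)
    {X : Matrix (Fin 2) (Fin 2) R} (h : ∀ i j, X i j ∈ s) : X.det ∈ s := by
  rw [det_fin_two]
  exact sub_mem (mul_mem (h _ _) (h _ _)) (mul_mem (h _ _) (h _ _))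

lemma trace_mem_of_entries_mem {R S : Type*} [CommRing R] [SetLike S R] [SubringClass S R] (s : S)
    {X : Matrix (Fin 2) (Fin 2) R} (h : ∀ i j, X i j ∈ s) : X.trace ∈ s := by
  rw [trace_fin_two]
  exact add_mem (h _ _) (h _ _)

lemma trace_inv_mul_mul {R : Type*} [CommRing R] (g : GL (Fin 2) R) (X : Matrix (Fin 2) (Fin 2) R) :
    ((g⁻¹).1 * X * g.1).trace = X.trace := by
  rw [trace_mul_comm, ← mul_assoc, ← Units.val_mul, mul_inv_cancel, Units.val_one, one_mul]

lemma det_inv_mul_mul {R : Type*} [CommRing R] (g : GL (Fin 2) R) (X : Matrix (Fin 2) (Fin 2) R) :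
    ((g⁻¹).1 * X * g.1).det = X.det := by
  have h : g.1.det * (g⁻¹).1.det = 1 := by
    rw [← det_mul, ← Units.val_mul, mul_inv_cancel, Units.val_one, det_one]
  rw [det_mul, det_mul]
  linear_combination X.det * h

/-- Traces and determinants of elements of the vertex algebra are integral at all places. -/
lemma IsFunctionFieldWithConstantField.hasConstantCharpolys
    (hK : IsFunctionFieldWithConstantField k K) (P : Place k K) (g : GL (Fin 2) P.Completion) :
    HasConstantCharpolys (P.vertexAlgebra g) := by
  intro X hX
  constructor
  · refine hK.exists_constant_of_mem P (trace_mem_of_entries_mem P.integralOutside hX.1) ?_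
    rw [← P.toCompletion_mem_iff]
    have := trace_mem_of_entries_mem P.completedRing hX.2
    rwa [trace_inv_mul_mul, ← AddMonoidHom.map_trace P.toCompletion] at this
  · refine hK.exists_constant_of_mem P (det_mem_of_entries_mem P.integralOutside hX.1) ?_
    rw [← P.toCompletion_mem_iff]
    have := det_mem_of_entries_mem P.completedRing hX.2
    rwa [det_inv_mul_mul, ← RingHom.mapMatrix_apply, ← RingHom.map_det] at this

/-- The entries of an invertible matrix over the completion have bounded value. -/
lemma Place.exists_entry_bound (P : Place k K) (g : GL (Fin 2) P.Completion) :
    ∃ γ : P.ring.ValueGroup, ∀ i j, (Valued.v (g.1 i j) : P.ring.ValueGroup) ≤ γ := by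
  obtain ⟨p, hp⟩ := Finite.exists_max fun p : Fin 2 × Fin 2 =>
    (Valued.v (g.1 p.1 p.2) : P.ring.ValueGroup)
  exact ⟨_, fun i j => hp (i, j)⟩

lemma Place.exists_nonzero_nonunit (P : Place k K) : ∃ b : K, b ≠ 0 ∧ P.ring.valuation b < 1 := by
  obtain ⟨y, hy⟩ : ∃ y, y ∉ P.ring := by
    by_contra h
    push Not at h
    exact P.ne_top (eq_top_iff.2 fun y _ => h y)
  have hy0 : y ≠ 0 := fun h => hy (h ▸ zero_mem _)
  exact ⟨y⁻¹, inv_ne_zero hy0, P.ring.mem_nonunits_iff.1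
    (P.ring.inv_mem_nonunits_iff.2 (Or.inr hy))⟩

/-- The poles at `P` of the entries of elements of the vertex algebra are bounded, so that the
algebra is finite-dimensional. -/
lemma IsFunctionFieldWithConstantField.finite_vertexAlgebra
    (hK : IsFunctionFieldWithConstantField k K) (P : Place k K) (g : GL (Fin 2) P.Completion) :
    FiniteDimensional k (P.vertexAlgebra g) := by
  obtain ⟨γ₁, h₁⟩ := P.exists_entry_bound g
  obtain ⟨γ₂, h₂⟩ := P.exists_entry_bound g⁻¹
  obtain ⟨b', hb'0, hb'⟩ := P.exists_nonzero_nonunit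
  obtain ⟨c, hc⟩ := P.ring.valuation_surjective (max 1 (γ₁ * γ₂))
  have hc1 : 1 ≤ P.ring.valuation c := hc ▸ le_max_left _ _
  have hc0 : c ≠ 0 := by
    rintro rfl
    rw [map_zero] at hc1
    exact not_lt_of_ge hc1 zero_lt_one
  have hcv : P.ring.valuation c ≠ 0 := (_root_.map_ne_zero _).2 hc0
  have hbound : ∀ X ∈ P.vertexAlgebra g, ∀ i j, P.ring.valuation (X i j) ≤ P.ring.valuation c := by
    intro X hX i j
    have hX' : X.map P.toCompletion =
        g.1 * ((g⁻¹).1 * X.map P.toCompletion * g.1) * (g⁻¹).1 := by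
      have hg : g.1 * (g⁻¹).1 = 1 := by rw [← Units.val_mul, mul_inv_cancel]; rfl
      simp only [← mul_assoc, hg, one_mul]
      rw [mul_assoc, hg, mul_one]
    rw [← P.valuation_toCompletion, ← map_apply (f := P.toCompletion), hX', hc]
    refine le_trans ?_ (le_max_right _ _)
    rw [mul_apply]
    refine Valuation.map_sum_le _ fun l _ => ?_
    rw [mul_apply, Finset.sum_mul]
    refine Valuation.map_sum_le _ fun m _ => ?_
    rw [map_mul, map_mul]
    refine mul_le_mul' ?_ (h₂ l j)
    calc _ ≤ γ₁ * 1 := mul_le_mul' (h₁ i m) (hX.2 m l)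
      _ = γ₁ := mul_one _
  have hb : P.ring.valuation (b' / c) < 1 := by
    rw [map_div₀]
    exact (div_lt_one₀ (zero_lt_iff.2 hcv)).2 (hb'.trans_le hc1)
  have hfin := hK.finite_boundedPole P (div_ne_zero hb'0 hc0) hb
  let T : P.vertexAlgebra g →ₗ[k] (Fin 2 → Fin 2 → P.boundedPole (b' / c)) :=
    { toFun := fun X i j => ⟨X.1 i j, X.2.1 i j, by
        rw [← P.ring.valuation_le_one_iff, div_mul_eq_mul_div, map_div₀, map_mul]
        refine div_le_one_of_le₀ ?_ zero_le
        calc _ ≤ 1 * P.ring.valuation c := mul_le_mul' hb'.le (hbound X X.2 i j)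
          _ = _ := one_mul _⟩
      map_add' := fun X Y => rfl
      map_smul' := fun a X => rfl }
  refine FiniteDimensional.of_injective T fun X Y h => Subtype.ext ?_
  ext i j
  exact congrArg Subtype.val (congrFun (congrFun h i) j)

/-- The units of the ring of elements integral outside `P` are constants: such a unit or its
inverse is integral at `P`. -/
lemma IsFunctionFieldWithConstantField.unit_constant (hK : IsFunctionFieldWithConstantField k K)
    (P : Place k K) (a : P.integralOutsideˣ) :
    ∃ c : k, c ≠ 0 ∧ algebraMap k K c = (a : P.integralOutside).1 := by
  have hmul : (a : P.integralOutside).1 * (↑a⁻¹ : P.integralOutside).1 = 1 :=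
    congrArg Subtype.val (Units.mul_inv a)
  have ha0 : (a : P.integralOutside).1 ≠ 0 := left_ne_zero_of_mul_eq_one hmul
  have hinv : (↑a⁻¹ : P.integralOutside).1 = ((a : P.integralOutside).1)⁻¹ :=
    eq_inv_of_mul_eq_one_right hmul
  have hne : ∀ c : k, algebraMap k K c = (a : P.integralOutside).1 → c ≠ 0 := by
    rintro c hc rfl
    exact ha0 (by rw [← hc, map_zero])
  rcases P.ring.mem_or_inv_mem (a : P.integralOutside).1 with h | h
  · obtain ⟨c, hc⟩ := hK.exists_constant_of_mem P (a : P.integralOutside).2 h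
    exact ⟨c, hne c hc, hc⟩
  · rw [← hinv] at h
    obtain ⟨c, hc⟩ := hK.exists_constant_of_mem P (↑a⁻¹ : P.integralOutside).2 h
    have hc' : algebraMap k K c⁻¹ = (a : P.integralOutside).1 := by
      rw [map_inv₀, hc, hinv, inv_inv]
    exact ⟨c⁻¹, hne _ hc', hc'⟩

namespace Place

/-- The matrix over `K` underlying an element of `GL₂(C)`. -/
def toMatrix (P : Place k K) : P.DrinfeldGroup →* Matrix (Fin 2) (Fin 2) K :=
  (RingHom.mapMatrix (m := Fin 2) P.integralOutside.val.toRingHom).toMonoidHom.comp (Units.coeHom _)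

lemma toMatrix_apply (P : Place k K) (M : P.DrinfeldGroup) (i j : Fin 2) :
    P.toMatrix M i j = (M.1 i j : K) := rfl

lemma toMatrix_injective (P : Place k K) : Function.Injective P.toMatrix := by
  intro M N h
  refine Units.ext ?_
  ext i j
  exact congrFun (congrFun h i) j

lemma toMatrix_det (P : Place k K) (M : P.DrinfeldGroup) :
    (P.toMatrix M).det = (M.1.det : K) :=
  (RingHom.map_det P.integralOutside.val.toRingHom M.1).symm

lemma toMatrix_trace (P : Place k K) (M : P.DrinfeldGroup) :
    (P.toMatrix M).trace = (M.1.trace : K) := by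
  simp [trace_fin_two, toMatrix_apply]

end Place

/-- The stabilizer of the vertex `g` consists of the elements of `GL₂(C)` in the vertex algebra:
an element of the stabilizer is of the form `z * u`, up to conjugation by `g`, with `z` a scalar and
`u` in `GL₂(𝒪)`, and `z` is a unit because the determinant is a constant. -/
lemma IsFunctionFieldWithConstantField.mem_vertexStabilizer_iff
    (hK : IsFunctionFieldWithConstantField k K) (P : Place k K) (g : GL (Fin 2) P.Completion)
    (M : P.DrinfeldGroup) :
    M ∈ P.vertexStabilizer (QuotientGroup.mk g) ↔ P.toMatrix M ∈ P.vertexAlgebra g := by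
  have hstab : M ∈ P.vertexStabilizer (QuotientGroup.mk g) ↔
      g⁻¹ * P.drinfeldEmbedding M * g ∈ P.scalarsCompletion ⊔ P.integralMatrices := by
    rw [Place.vertexStabilizer, Subgroup.mem_comap, MulAction.mem_stabilizer_iff,
      MulAction.Quotient.smul_mk, eq_comm, QuotientGroup.eq, smul_eq_mul, mul_assoc]
  have hnormal : P.scalarsCompletion.Normal := by
    refine ⟨?_⟩
    rintro _ ⟨z, rfl⟩ h
    refine ⟨z, ?_⟩
    rw [eq_mul_inv_iff_mul_eq]
    exact Units.ext (scalar_commute (z : P.Completion) (fun _ => mul_comm _ _) h.1)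
  obtain ⟨c, hc0, hc⟩ := hK.unit_constant P (GeneralLinearGroup.det M)
  have hc' : algebraMap k K c = (P.toMatrix M).det := by
    rw [Place.toMatrix_det]
    exact hc
  have hdet0 : (P.toMatrix M).det ≠ 0 := by
    rw [← hc']
    exact (_root_.map_ne_zero _).2 hc0
  have hentry : ∀ N : P.DrinfeldGroup, (g⁻¹ * P.drinfeldEmbedding N * g).1 =
      (g⁻¹).1 * (P.toMatrix N).map P.toCompletion * g.1 := fun N => rfl
  rw [hstab, Place.mem_vertexAlgebra, Subgroup.mem_sup_of_normal_left]
  constructor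
  · rintro ⟨_, ⟨z, rfl⟩, _, ⟨U, rfl⟩, hzu⟩
    refine ⟨fun i j => (M.1 i j).2, ?_⟩
    rw [← hentry, ← hzu]
    have hdet : (z : P.Completion) ^ 2 * (U.1.det : P.Completion) =
        P.toCompletion (algebraMap k K c) := by
      have h1 := congrArg (fun h : GL (Fin 2) P.Completion => h.1.det) hzu
      simp only [hentry, det_inv_mul_mul] at h1
      rw [hc', RingHom.map_det, RingHom.mapMatrix_apply, ← h1, Units.val_mul, det_mul]
      congr 1
      · change _ = ((scalar (Fin 2)) (z : P.Completion)).det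
        simp
    have hvk : ∀ d : k, (Valued.v (P.toCompletion (algebraMap k K d)) : P.ring.ValueGroup) ≤ 1 :=
      fun d => by
        rw [P.valuation_toCompletion, P.ring.valuation_le_one_iff]
        exact P.algebraMap_mem d
    have hU : (U.1.det : P.Completion) * ((U⁻¹).1.det : P.Completion) = 1 := by
      have : U.1.det * (U⁻¹).1.det = 1 := by
        rw [← det_mul, ← Units.val_mul, mul_inv_cancel, Units.val_one, det_one]
      exact congrArg Subtype.val this
    -- `z ^ 2 = c * det U⁻¹` is integral, hence so is `z`
    have hz2 : (z : P.Completion) ^ 2 =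
        P.toCompletion (algebraMap k K c) * ((U⁻¹).1.det : P.Completion) := by
      rw [← hdet, mul_assoc, hU, mul_one]
    have hz : (z : P.Completion) ∈ P.completedRing := by
      have h1 : (Valued.v ((z : P.Completion) ^ 2) : P.ring.ValueGroup) ≤ 1 := by
        rw [hz2, map_mul]
        calc _ ≤ (1 : P.ring.ValueGroup) * 1 := mul_le_mul' (hvk c) (U⁻¹).1.det.2
          _ = 1 := mul_one _
      rw [map_pow] at h1
      exact (pow_le_one_iff two_ne_zero).1 h1
    intro i j
    have e : (GeneralLinearGroup.scalar (Fin 2) z *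
        GeneralLinearGroup.map (n := Fin 2) P.completedRing.subtype U).1 i j =
        (z : P.Completion) * (U.1 i j : P.Completion) := by
      change ((scalar (Fin 2)) (z : P.Completion) * U.1.map P.completedRing.subtype) i j = _
      rw [scalar_apply, diagonal_mul]
      rfl
    rw [e]
    exact mul_mem hz (U.1 i j).2
  · intro hM
    obtain ⟨Y, hY, hXY, hYX⟩ := (hK.hasConstantCharpolys P g).inv_mem hM hdet0
    have hY' : P.toMatrix M⁻¹ = Y := by
      have h1 : P.toMatrix M⁻¹ * P.toMatrix M = 1 := by rw [← map_mul, inv_mul_cancel, map_one]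
      calc P.toMatrix M⁻¹ = P.toMatrix M⁻¹ * (P.toMatrix M * Y) := by rw [hXY, mul_one]
        _ = Y := by rw [← mul_assoc, h1, one_mul]
    rw [← hY'] at hY
    have hinv : (g⁻¹ * P.drinfeldEmbedding M * g) * (g⁻¹ * P.drinfeldEmbedding M⁻¹ * g) = 1 := by
      rw [map_inv]
      group
    let U : GL (Fin 2) P.completedRing :=
      ⟨Matrix.of fun i j => ⟨_, hM.2 i j⟩, Matrix.of fun i j => ⟨_, hY.2 i j⟩, by
        refine Matrix.map_injective (f := P.completedRing.subtype) Subtype.val_injective ?_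
        change Matrix.map _ P.completedRing.subtype = Matrix.map _ P.completedRing.subtype
        rw [Matrix.map_mul, Matrix.map_one _ (map_zero _) (map_one _)]
        exact congrArg Units.val hinv, by
        refine Matrix.map_injective (f := P.completedRing.subtype) Subtype.val_injective ?_
        change Matrix.map _ P.completedRing.subtype = Matrix.map _ P.completedRing.subtype
        rw [Matrix.map_mul, Matrix.map_one _ (map_zero _) (map_one _)]
        exact congrArg Units.val (mul_eq_one_comm.1 hinv)⟩
    exact ⟨1, one_mem _, GeneralLinearGroup.map P.completedRing.subtype U, ⟨U, rfl⟩, by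
      rw [one_mul]
      exact Units.ext rfl⟩

/-- The stabilizer of a vertex is the unit group of the vertex algebra. -/
lemma IsFunctionFieldWithConstantField.exists_mulEquiv_units
    (hK : IsFunctionFieldWithConstantField k K) (P : Place k K) (g : GL (Fin 2) P.Completion) :
    ∃ e : P.vertexStabilizer (QuotientGroup.mk g) ≃* (P.vertexAlgebra g)ˣ,
      ∀ M, ((e M : P.vertexAlgebra g) : Matrix (Fin 2) (Fin 2) K) = P.toMatrix M := by
  let f : P.vertexStabilizer (QuotientGroup.mk g) →* P.vertexAlgebra g :=
    { toFun := fun M => ⟨P.toMatrix M, (hK.mem_vertexStabilizer_iff P g M).1 M.2⟩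
      map_one' := Subtype.ext (map_one P.toMatrix)
      map_mul' := fun M N => Subtype.ext (map_mul P.toMatrix M.1 N.1) }
  refine ⟨MulEquiv.ofBijective f.toHomUnits ⟨fun M N h => ?_, fun u => ?_⟩, fun M => rfl⟩
  · exact Subtype.ext (P.toMatrix_injective (congrArg (fun a => (Units.val a).1) h))
  · let M : P.DrinfeldGroup :=
      ⟨Matrix.of fun i j => ⟨(u : P.vertexAlgebra g).1 i j, (u : P.vertexAlgebra g).2.1 i j⟩,
        Matrix.of fun i j => ⟨(↑u⁻¹ : P.vertexAlgebra g).1 i j, (↑u⁻¹ : P.vertexAlgebra g).2.1 i j⟩,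
        by
          refine Matrix.map_injective (f := P.integralOutside.val) Subtype.val_injective ?_
          change Matrix.map _ P.integralOutside.val.toRingHom =
            Matrix.map _ P.integralOutside.val.toRingHom
          rw [Matrix.map_mul, Matrix.map_one _ (map_zero _) (map_one _)]
          exact congrArg Subtype.val (Units.mul_inv u),
        by
          refine Matrix.map_injective (f := P.integralOutside.val) Subtype.val_injective ?_
          change Matrix.map _ P.integralOutside.val.toRingHom =
            Matrix.map _ P.integralOutside.val.toRingHom
          rw [Matrix.map_mul, Matrix.map_one _ (map_zero _) (map_one _)]
          exact congrArg Subtype.val (Units.inv_mul u)⟩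
    have hM : P.toMatrix M = (u : P.vertexAlgebra g).1 := rfl
    exact ⟨⟨M, (hK.mem_vertexStabilizer_iff P g M).2 (hM ▸ (u : P.vertexAlgebra g).2)⟩,
      Units.ext (Subtype.ext hM)⟩

end

/-! ### Eigenvalues and scalar matrices -/

section

open Matrix

variable {k : Type u} {K : Type v} [Field k] [Field K] [Algebra k K]

namespace Place

/-- The two eigenvalues are determined by their sum and product. -/
lemma exists_eigenvalues (P : Place k K) (M : P.DrinfeldGroup) :
    ∃ α β : AlgebraicClosure K, P.eigenvalues M = {α, β} ∧
      α + β = algebraMap K (AlgebraicClosure K) (P.toMatrix M).trace ∧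
      α * β = algebraMap K (AlgebraicClosure K) (P.toMatrix M).det := by
  set j := algebraMap K (AlgebraicClosure K)
  set t := j (P.toMatrix M).trace with ht
  set d := j (P.toMatrix M).det with hd
  have hpoly : (M.1.charpoly.map (j.comp P.integralOutside.val.toRingHom)) =
      Polynomial.X ^ 2 - C t * Polynomial.X + C d := by
    rw [charpoly_fin_two, ht, hd, P.toMatrix_trace, P.toMatrix_det]
    simp
  have hdeg : (Polynomial.X ^ 2 - C t * Polynomial.X + C d).degree = 2 := by
    compute_degree!
  obtain ⟨α, hα⟩ := IsAlgClosed.exists_root (Polynomial.X ^ 2 - C t * Polynomial.X + C d)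
    (by rw [hdeg]; decide)
  have hα' : α ^ 2 - t * α + d = 0 := by simpa using hα
  have hprod : α * (t - α) = d := by linear_combination -hα'
  refine ⟨α, t - α, ?_, by ring, hprod⟩
  have hfac : Polynomial.X ^ 2 - C t * Polynomial.X + C d =
      (Polynomial.X - C α) * (Polynomial.X - C (t - α)) := by
    rw [← hprod]
    simp only [C_mul, C_sub]
    ring
  unfold Place.eigenvalues
  rw [hpoly, hfac, roots_mul (mul_ne_zero (X_sub_C_ne_zero _) (X_sub_C_ne_zero _)), roots_X_sub_C,
    roots_X_sub_C]
  rfl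

lemma hasDistinctEigenvalues_iff (P : Place k K) (M : P.DrinfeldGroup) :
    P.HasDistinctEigenvalues M ↔ (P.toMatrix M).trace ^ 2 - 4 * (P.toMatrix M).det ≠ 0 := by
  obtain ⟨α, β, h, ht, hd⟩ := P.exists_eigenvalues M
  have hsq : algebraMap K (AlgebraicClosure K)
      ((P.toMatrix M).trace ^ 2 - 4 * (P.toMatrix M).det) = (α - β) ^ 2 := by
    rw [map_sub, map_pow, map_mul, map_ofNat, ← ht, ← hd]
    ring
  rw [HasDistinctEigenvalues, h, ← (_root_.map_ne_zero (algebraMap K (AlgebraicClosure K))), hsq,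
    pow_ne_zero_iff two_ne_zero, sub_ne_zero]
  simp

lemma HasRepeatedEigenvalues.disc_eq_zero {P : Place k K} {M : P.DrinfeldGroup}
    (h : P.HasRepeatedEigenvalues M) :
    (P.toMatrix M).trace ^ 2 - 4 * (P.toMatrix M).det = 0 := by
  by_contra h'
  exact h ((P.hasDistinctEigenvalues_iff M).2 h')

lemma HasEigenvaluesIn.exists_eq {P : Place k K} {M : P.DrinfeldGroup}
    (h : P.HasEigenvaluesIn M) : ∃ a b : k, (P.toMatrix M).trace = algebraMap k K (a + b) ∧
      (P.toMatrix M).det = algebraMap k K (a * b) := by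
  obtain ⟨α, β, he, ht, hd⟩ := P.exists_eigenvalues M
  rw [HasEigenvaluesIn, he] at h
  obtain ⟨a, rfl⟩ := h α (by simp)
  obtain ⟨b, rfl⟩ := h β (by simp)
  refine ⟨a, b, (algebraMap K (AlgebraicClosure K)).injective ?_,
    (algebraMap K (AlgebraicClosure K)).injective ?_⟩
  · rw [← ht, map_add, map_add]
  · rw [← hd, map_mul, map_mul]

lemma HasEigenvaluesNotIn.ne_zero {P : Place k K} {M : P.DrinfeldGroup}
    (h : P.HasEigenvaluesNotIn M) (c : k) :
    algebraMap k K c ^ 2 - (P.toMatrix M).trace * algebraMap k K c + (P.toMatrix M).det ≠ 0 := by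
  obtain ⟨α, β, he, ht, hd⟩ := P.exists_eigenvalues M
  intro h0
  have h1 := congrArg (algebraMap K (AlgebraicClosure K)) h0
  rw [map_add, map_sub, map_mul, map_pow, map_zero, ← ht, ← hd] at h1
  have h2 : (algebraMap K (AlgebraicClosure K) (algebraMap k K c) - α) *
      (algebraMap K (AlgebraicClosure K) (algebraMap k K c) - β) = 0 := by
    linear_combination h1
  rw [HasEigenvaluesNotIn, he] at h
  rcases mul_eq_zero.1 h2 with h3 | h3
  · exact h α (by simp) ⟨c, sub_eq_zero.1 h3⟩
  · exact h β (by simp) ⟨c, sub_eq_zero.1 h3⟩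

/-- The scalar matrices with entry in `k`. -/
def constantScalar (P : Place k K) : kˣ →* P.DrinfeldGroup :=
  (Matrix.GeneralLinearGroup.scalar (Fin 2) (R := P.integralOutside)).comp
    (Units.map (algebraMap k P.integralOutside).toMonoidHom)

lemma toMatrix_constantScalar (P : Place k K) (c : kˣ) :
    P.toMatrix (P.constantScalar c) = algebraMap k K c • 1 := by
  ext i j
  rw [toMatrix_apply, Matrix.smul_apply, one_apply]
  change (((scalar (Fin 2)) (algebraMap k P.integralOutside c) i j : P.integralOutside) : K) = _
  rw [scalar_apply, diagonal_apply]
  split <;> simp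

lemma constantScalar_injective (P : Place k K) : Function.Injective P.constantScalar := by
  intro c d h
  have h1 := congrArg (fun M => P.toMatrix M 0 0) h
  simp only [toMatrix_constantScalar] at h1
  exact Units.ext ((algebraMap k K).injective (by simpa using h1))

end Place

lemma IsFunctionFieldWithConstantField.range_constantScalar
    (hK : IsFunctionFieldWithConstantField k K) (P : Place k K) :
    P.constantScalar.range = P.scalars := by
  apply le_antisymm
  · rintro _ ⟨c, rfl⟩
    exact ⟨_, rfl⟩
  · rintro _ ⟨a, rfl⟩
    obtain ⟨c, hc0, hc⟩ := hK.unit_constant P a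
    refine ⟨Units.mk0 c hc0, ?_⟩
    refine congrArg (Matrix.GeneralLinearGroup.scalar (Fin 2)) (Units.ext (Subtype.ext ?_))
    exact hc

end

end

theorem theoremA {k : Type u} {K : Type v} [Field k] [Field K] [Algebra k K]
    (hK : IsFunctionFieldWithConstantField k K) (P : Place k K)
    (hk : ¬ QuadraticallyClosed k) (x : P.TreeVertex) :
    -- (a)
    (((∀ M ∈ P.vertexStabilizer x, P.HasEigenvaluesIn M) ∧
        (∃ M ∈ P.vertexStabilizer x, P.HasDistinctEigenvalues M)) →
      ∃ (N : Subgroup (P.vertexStabilizer x)) (_ : N.Normal),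
        IsFiniteDimensionalVectorGroup k N ∧
        Nonempty ((P.vertexStabilizer x ⧸ N) ≃* (kˣ × kˣ))) ∧
    -- (b)
    ((∀ M ∈ P.vertexStabilizer x, P.HasRepeatedEigenvalues M ∧ P.HasEigenvaluesIn M) →
      P.scalars ≤ P.vertexStabilizer x ∧ Nonempty (P.scalars ≃* kˣ) ∧
      ∃ N : Subgroup (P.vertexStabilizer x),
        IsFiniteDimensionalVectorGroup k N ∧
        IsInternalDirectProduct (P.scalars.subgroupOf (P.vertexStabilizer x)) N) ∧
    -- (c)
    ((∃ M ∈ P.vertexStabilizer x, P.HasDistinctEigenvalues M ∧ P.HasEigenvaluesNotIn M) →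
      ((∃ (L : Type v) (_ : Field L) (_ : Algebra k L),
          Module.finrank k L = 2 ∧ Algebra.IsSeparable k L ∧
          Nonempty (P.vertexStabilizer x ≃* Lˣ)) ∨
        Nonempty (P.vertexStabilizer x ≃* GL (Fin 2) k) ∨
        (∃ (Q : Type v) (_ : DivisionRing Q) (_ : Algebra k Q),
          Algebra.IsCentral k Q ∧ Module.finrank k Q = 4 ∧
          Nonempty (P.vertexStabilizer x ≃* Qˣ)))) ∧
    -- (d)
    (((∀ M ∈ P.vertexStabilizer x, P.HasRepeatedEigenvalues M) ∧
        (∃ M ∈ P.vertexStabilizer x, P.HasEigenvaluesNotIn M)) →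
      CharP k 2 ∧
      ∃ (F : Type v) (_ : Field F) (_ : Algebra k F) (m : ℕ),
        1 ≤ m ∧ IsPurelyInseparable k F ∧ Module.finrank k F = 2 ^ m ∧
        Nonempty (P.vertexStabilizer x ≃* Fˣ) ∧
        ∀ P' : Place k K, 2 ^ (m - 1) ∣ P'.degree) := by
  obtain ⟨g, rfl⟩ := QuotientGroup.mk_surjective x
  obtain ⟨e, he⟩ := hK.exists_mulEquiv_units P g
  have hA := hK.hasConstantCharpolys P g
  have hfin := hK.finite_vertexAlgebra P g
  have hmem := hK.mem_vertexStabilizer_iff P g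
  -- every invertible matrix in the vertex algebra comes from the stabilizer
  have hlift : ∀ X ∈ P.vertexAlgebra g, X.det ≠ 0 →
      ∃ M ∈ P.vertexStabilizer (QuotientGroup.mk g), P.toMatrix M = X := fun X hX hd =>
    ⟨(e.symm (hA.unit hX hd)).1, (e.symm (hA.unit hX hd)).2, by
      rw [← he, e.apply_symm_apply]
      rfl⟩
  have hdet : ∀ M ∈ P.vertexStabilizer (QuotientGroup.mk g), (P.toMatrix M).det ≠ 0 :=
    fun M hM => he ⟨M, hM⟩ ▸ det_ne_zero_of_unit (e ⟨M, hM⟩)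
  refine ⟨?_, ?_, ?_, ?_⟩
  · rintro ⟨hall, M, hM, hMd⟩
    obtain ⟨f, hf, hker⟩ := exists_hom_comp e (hA.units_of_split hk
      (fun X hX hd => by
        obtain ⟨M, hM, rfl⟩ := hlift X hX hd
        exact (hall M hM).exists_eq)
      ⟨_, (hmem M).1 hM, hdet M hM, (P.hasDistinctEigenvalues_iff M).1 hMd⟩)
    exact ⟨f.ker, inferInstance, hker, ⟨QuotientGroup.quotientKerEquivOfSurjective f hf⟩⟩
  · intro hall
    obtain ⟨N, hN, hscal, hdecomp⟩ := hA.units_of_repeated fun X hX hd => by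
      obtain ⟨M, hM, rfl⟩ := hlift X hX hd
      obtain ⟨a, b, ht, hd'⟩ := (hall M hM).2.exists_eq
      have hdisc := (hall M hM).1.disc_eq_zero
      have hab : a = b := by
        rw [ht, hd'] at hdisc
        simp only [map_add, map_mul] at hdisc
        refine (algebraMap k K).injective (sub_eq_zero.1 (pow_eq_zero_iff two_ne_zero |>.1
          (?_ : (algebraMap k K a - algebraMap k K b) ^ 2 = 0)))
        linear_combination hdisc
      subst hab
      exact ⟨a, ht, hd'⟩
    have hconst : ∀ c : kˣ, P.constantScalar c ∈ P.vertexStabilizer (QuotientGroup.mk g) :=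
      fun c => by
        rw [hmem, P.toMatrix_constantScalar]
        exact algebraMap_smul_mem _ (P.vertexAlgebra g).one_mem
    have hrange := hK.range_constantScalar P
    have hZ : P.scalars ≤ P.vertexStabilizer (QuotientGroup.mk g) := by
      rw [← hrange]
      rintro _ ⟨c, rfl⟩
      exact hconst c
    refine ⟨hZ, ⟨((MonoidHom.ofInjective P.constantScalar_injective).trans
      (MulEquiv.subgroupCongr hrange)).symm⟩, N.map e.symm.toMonoidHom,
      hN.of_mulEquiv (e.symm.subgroupMap N).symm, ?_, ?_, ?_⟩
    · intro a ha b _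
      rw [Subgroup.mem_subgroupOf, ← hrange] at ha
      obtain ⟨c, hc⟩ := ha
      refine Subtype.ext (P.toMatrix_injective ?_)
      change P.toMatrix (a.1 * b.1) = P.toMatrix (b.1 * a.1)
      rw [map_mul, map_mul, ← hc, P.toMatrix_constantScalar, smul_mul_assoc, mul_smul_comm, one_mul,
        mul_one]
    · rw [eq_bot_iff]
      rintro a ⟨ha, b, hb, rfl⟩
      obtain ⟨c, hc⟩ := hrange.ge (Subgroup.mem_subgroupOf.1 ha)
      have hb1 : b = 1 := hscal b hb (algebraMap k K c) (by
        have := he (e.symm b)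
        rw [e.apply_symm_apply] at this
        rw [this, ← P.toMatrix_constantScalar, hc]
        rfl)
      rw [hb1, map_one]
      exact one_mem _
    · rw [eq_top_iff]
      intro a _
      obtain ⟨c, hc0, n, hn, hcn⟩ := hdecomp (e a)
      have ha : a = ⟨_, hconst (Units.mk0 c hc0)⟩ * e.symm n := by
        refine e.injective (Units.ext (Subtype.ext ?_))
        rw [hcn, map_mul, e.apply_symm_apply]
        change _ = (e ⟨_, hconst (Units.mk0 c hc0)⟩ : P.vertexAlgebra g).1 *
          (n : P.vertexAlgebra g).1
        rw [he, P.toMatrix_constantScalar, smul_mul_assoc, one_mul]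
        rfl
      rw [ha]
      exact Subgroup.mul_mem_sup (Subgroup.mem_subgroupOf.2 (hrange.le ⟨_, rfl⟩)) ⟨n, hn, rfl⟩
  · rintro ⟨M, hM, hMd, hMn⟩
    rcases hA.units_of_separable hK.constants ((hmem M).1 hM) hMn.ne_zero
      ((P.hasDistinctEigenvalues_iff M).1 hMd) with
      ⟨L, i1, i2, h1, h2, ⟨f⟩⟩ | ⟨⟨f⟩⟩ | ⟨Q, i1, i2, h1, h2, ⟨f⟩⟩
    · exact Or.inl ⟨L, i1, i2, h1, h2, ⟨e.trans f⟩⟩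
    · exact Or.inr (Or.inl ⟨e.trans f⟩)
    · exact Or.inr (Or.inr ⟨Q, i1, i2, h1, h2, ⟨e.trans f⟩⟩)
  · rintro ⟨hall, M, hM, hMn⟩
    obtain ⟨hchar, F, i1, i2, m, hm, hpi, hrank, ⟨f⟩, hdvd⟩ :=
      hA.units_of_inseparable hK.constants (fun X hX hd => by
        obtain ⟨M, hM, rfl⟩ := hlift X hX hd
        exact (hall M hM).disc_eq_zero) ((hmem M).1 hM) (hdet M hM) hMn.ne_zero
    exact ⟨hchar, F, i1, i2, m, hm, hpi, hrank, ⟨e.trans f⟩, hdvd⟩
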